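/- Setting. Let $x^1,\dots,x^N\in\mathbb R^{d}$ and $y^1,\dots,y^N\in\mathbb R^{e}$ be training data, let $\Lambda_0,\Sigma_0$ be positive definite ($d\times d$ and $e\times e$), and let $\eta_0>d-1$, $\nu_0>e-1$, $\kappa_0>0$, $\mu_0\in\mathbb R^e$. Write $\operatorname N$, $\operatorname W$, $\operatorname{IW}$ for the normal, Wishart and inverse-Wishart densities. The hidden variables are $\theta=(\Lambda,(\mu_c,\Sigma_c)_{c=1}^C)$, with prior $$p(\theta)=\operatorname W(\Lambda\mid\Lambda_0,\eta_0)\prod_c\operatorname N(\mu_c\mid\mu_0,\kappa_0^{-1}\Sigma_c)\operatorname{IW}(\Sigma_c\mid\Sigma_0,\nu_0),$$ and $(u^n,z^n)_{n=1}^N$ with $u^n\in\{1,\dots,N\}\setminus\{n\}$, $z^n\in\{1,\dots,C\}$; the pseudojoint $p$ of data and hidden variables is $p(\theta)$ times $$\prod_{n}\frac{\operatorname N(x^n\mid x^{u^n},\Lambda^{-1})}{\sum_{n''\neq n}\operatorname N(x^n\mid x^{n''},\Lambda^{-1})}\cdot\frac{\operatorname N(y^{u^n}\mid\mu_{z^n},\Sigma_{z^n})}{\sum_{c'}\operatorname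 N(y^{u^n}\mid\mu_{c'},\Sigma_{c'})}\cdot\operatorname N(y^n\mid\mu_{z^n},\Sigma_{z^n}).$$ For a density $q$ of the hidden variables, $\operatorname{ELBO}(q)=\mathbb E^{q}\log(p/q)$. Consider mean-field densities $$q_{S}=\operatorname W(\Lambda\mid S,\eta_0)\;q\big((\mu_c,\Sigma_c)_c\big)\;q\big((u^n,z^n)_n\big),\qquad S \text{ positive definite},$$ where the last two factors are fixed but arbitrary, with $\Omega_{nn'}=q(u^n=n')$. Let $q^l=q_{\Lambda^l}$, where $\Lambda^l=L^lL^{l\mathrm T}$ is the Cholesky factorization, be the current iterate, and assume that the expectation $\operatorname{ELBO}(q^l)$ converges absolutely. Let $A$ be a random lower triangular $d\times d$ matrix with independent entries, $A_{ii}^2\sim\chi^2_{\eta_0+1-i}$ and $A_{ii'}\sim\operatorname N(0,1)$ for $i>i'$. For $L$ lower triangular with positive diagonal (a Cholesky factor), put $$\begin{aligned}J(L)={}&-\eta_0\log\det L+\sum_n\mathbb E\log\Big(\sum_{n'\neq n}\exp\big(-\tfrac12(x^n-x^{n'})^{\mathrm T}LAA^{\mathrm T}L^{\mathrm T}(x^n-x^{n'})\big)\Big)\\&+\frac{\eta_0}{2}\operatorname{tr}\Big(L^{\mathrm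 T}\Big(\Lambda_0^{-1}+\sum_n\sum_{n'\ne n}\Omega_{nn'}(x^n-x^{n'})(x^n-x^{n'})^{\mathrm T}\Big)L\Big).\end{aligned}$$ Proposition 4 (Stochastic gate optimization). The expectations in $J$ and in $\operatorname{ELBO}(q_S)$ converge absolutely, for all Cholesky factors $L$ and all positive definite $S$. There is a constant $K$ not depending on $L$ such that $\operatorname{ELBO}(q_{LL^{\mathrm T}})=K-J(L)$ for every Cholesky factor $L$. Every positive definite $S$ has a unique Cholesky factor, and $LL^{\mathrm T}$ maximizes $S\mapsto\operatorname{ELBO}(q_S)$ over the positive definite matrices if and only if $L$ minimizes $J$ over the Cholesky factors. The minimum of $J$ is attained. Thus the update that maximizes the ELBO in $\Lambda^l$ without linearizing the first transition is $\Lambda^{l+1}=L^{l+1}L^{(l+1)\mathrm T}$ with $L^{l+1}\in\arg\min_L J(L)$. -/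

import Mathlib

open MeasureTheory ProbabilityTheory
open scoped Matrix

namespace SimMoE

/-! ### Symmetric matrices and Lebesgue measure on them -/

/-- Coordinates of a symmetric `d × d` matrix: its entries on and below the diagonal. The `volume`
on this space is the product `∏_{j ≤ i} dX_{ij}`, the usual Lebesgue measure on symmetric
matrices. -/
abbrev SymCoord (d : ℕ) : Type := {p : Fin d × Fin d // p.2 ≤ p.1} → ℝ

/-- The symmetric matrix with given entries on and below the diagonal. -/
def symMat {d : ℕ} (v : SymCoord d) : Matrix (Fin d) (Fin d) ℝ :=
  Matrix.of fun i j => if h : j ≤ i then v ⟨(i, j), h⟩ else v ⟨(j, i), le_of_not_ge h⟩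

/-! ### Densities -/

/-- Density of the multivariate normal distribution with mean `m` and covariance `S`. -/
noncomputable def normalPDF {d : ℕ} (m : Fin d → ℝ) (S : Matrix (Fin d) (Fin d) ℝ)
    (x : Fin d → ℝ) : ℝ :=
  (2 * Real.pi) ^ (-(d : ℝ) / 2) * S.det ^ (-(1 : ℝ) / 2) *
    Real.exp (-(1 / 2) * ((x - m) ⬝ᵥ (S⁻¹ *ᵥ (x - m))))

/-- Multivariate gamma function `Γ_d(a) = π^{d(d-1)/4} ∏_{j=1}^d Γ(a + (1 - j)/2)`. -/
noncomputable def multiGamma (d : ℕ) (a : ℝ) : ℝ :=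
  Real.pi ^ ((d : ℝ) * ((d : ℝ) - 1) / 4) * ∏ j : Fin d, Real.Gamma (a - ((j : ℕ) : ℝ) / 2)

open Classical in
/-- Density `W(X ∣ X₀, ν)` of the Wishart distribution (zero off the positive definite
matrices). -/
noncomputable def wishartPDF {d : ℕ} (X₀ : Matrix (Fin d) (Fin d) ℝ) (ν : ℝ)
    (X : Matrix (Fin d) (Fin d) ℝ) : ℝ :=
  if X.PosDef then
    1 / (2 ^ (ν * d / 2) * X₀.det ^ (ν / 2) * multiGamma d (ν / 2)) *
      X.det ^ ((ν - d - 1) / 2) * Real.exp (-(X₀⁻¹ * X).trace / 2)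
  else 0

open Classical in
/-- Density `IW(X ∣ X₀, ν)` of the inverse-Wishart distribution (zero off the positive definite
matrices). -/
noncomputable def invWishartPDF {d : ℕ} (X₀ : Matrix (Fin d) (Fin d) ℝ) (ν : ℝ)
    (X : Matrix (Fin d) (Fin d) ℝ) : ℝ :=
  if X.PosDef then
    X₀.det ^ (ν / 2) / (2 ^ (ν * d / 2) * multiGamma d (ν / 2)) *
      X.det ^ (-(ν + d + 1) / 2) * Real.exp (-(X₀ * X⁻¹).trace / 2)
  else 0

/-! ### The model -/

/-- Training data and hyperparameters. -/
structure Model (N dX dY : ℕ) where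
  /-- training inputs -/
  x : Fin N → Fin dX → ℝ
  /-- training outputs -/
  y : Fin N → Fin dY → ℝ
  /-- scale matrix of the Wishart prior on `Λ` -/
  Λ₀ : Matrix (Fin dX) (Fin dX) ℝ
  /-- degrees of freedom of the Wishart prior on `Λ` -/
  η₀ : ℝ
  /-- prior mean of the `μ_c` -/
  μ₀ : Fin dY → ℝ
  /-- prior precision factor of the `μ_c` -/
  κ₀ : ℝ
  /-- scale matrix of the inverse-Wishart prior on the `Σ_c` -/
  S₀ : Matrix (Fin dY) (Fin dY) ℝ
  /-- degrees of freedom of the inverse-Wishart prior on the `Σ_c` -/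
  ν₀ : ℝ

/-- The hyperparameters give well-defined priors. -/
structure Model.Valid {N dX dY : ℕ} (M : Model N dX dY) : Prop where
  Λ₀_posDef : M.Λ₀.PosDef
  S₀_posDef : M.S₀.PosDef
  η₀_gt : (dX : ℝ) - 1 < M.η₀
  ν₀_gt : (dY : ℝ) - 1 < M.ν₀
  κ₀_pos : 0 < M.κ₀

/-- The expert parameters `(μ_c, Σ_c)_c`. -/
abbrev Experts (C dY : ℕ) : Type := Fin C → (Fin dY → ℝ) × SymCoord dY

/-- The parameters `θ = (Λ, (μ_c, Σ_c)_c)`. -/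
abbrev Param (C dX dY : ℕ) : Type := SymCoord dX × Experts C dY

/-- The latent variables `(u^n, z^n)_n`, with `u^n ≠ n`. -/
abbrev Latent (N C : ℕ) : Type := (n : Fin N) → {n' : Fin N // n' ≠ n} × Fin C

section

variable {N C dX dY : ℕ}

/-- `N(x^n ∣ x^{n'}, Λ⁻¹) / ∑_{n'' ≠ n} N(x^n ∣ x^{n''}, Λ⁻¹)` -/
noncomputable def firstTransition (M : Model N dX dY) (Λ : Matrix (Fin dX) (Fin dX) ℝ)
    (n : Fin N) (n' : {n' : Fin N // n' ≠ n}) : ℝ :=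
  normalPDF (M.x n') Λ⁻¹ (M.x n) /
    ∑ n'' : {n'' : Fin N // n'' ≠ n}, normalPDF (M.x n'') Λ⁻¹ (M.x n)

/-- `N(y^{n'} ∣ μ_c, Σ_c) / ∑_{c'} N(y^{n'} ∣ μ_{c'}, Σ_{c'})` -/
noncomputable def secondTransition (M : Model N dX dY) (m : Experts C dY)
    (n' : Fin N) (c : Fin C) : ℝ :=
  normalPDF (m c).1 (symMat (m c).2) (M.y n') /
    ∑ c' : Fin C, normalPDF (m c').1 (symMat (m c').2) (M.y n')

/-- The full conditional of `(y^n, u^n, z^n)` at `u^n = a.1`, `z^n = a.2`. -/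
noncomputable def fullConditional (M : Model N dX dY) (θ : Param C dX dY) (n : Fin N)
    (a : {n' : Fin N // n' ≠ n} × Fin C) : ℝ :=
  firstTransition M (symMat θ.1) n a.1 * secondTransition M θ.2 (a.1 : Fin N) a.2 *
    normalPDF (θ.2 a.2).1 (symMat (θ.2 a.2).2) (M.y n)

/-- The prior density of `θ`. -/
noncomputable def prior (M : Model N dX dY) (θ : Param C dX dY) : ℝ :=
  wishartPDF M.Λ₀ M.η₀ (symMat θ.1) *
    ∏ c : Fin C, (normalPDF M.μ₀ ((1 / M.κ₀) • symMat (θ.2 c).2) (θ.2 c).1 *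
      invWishartPDF M.S₀ M.ν₀ (symMat (θ.2 c).2))

/-- The pseudojoint: prior times complete-data pseudolikelihood. -/
noncomputable def pseudoJoint (M : Model N dX dY) (θ : Param C dX dY) (w : Latent N C) : ℝ :=
  (∏ n : Fin N, fullConditional M θ n (w n)) * prior M θ

/-! ### Variational posterior and evidence lower bound -/

/-- Probability mass functions `q((u^n, z^n)_n)` of the latent variables. -/
structure IsLatentPMF (r : Latent N C → ℝ) : Prop where
  nonneg : ∀ w, 0 ≤ r w
  sum_eq_one : ∑ w, r w = 1

/-- Probability densities `q((μ_c, Σ_c)_c)`, carried by positive definite `Σ_c`. -/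
structure IsExpertsPDF (g : Experts C dY → ℝ) : Prop where
  nonneg : ∀ m, 0 ≤ g m
  support : ∀ m, g m ≠ 0 → ∀ c, (symMat (m c).2).PosDef
  integral_eq_one : ∫ m, g m = 1

/-- The mean-field density `q(θ, (u^n, z^n)_n) = W(Λ ∣ S, η₀) q((μ_c, Σ_c)_c) q((u^n, z^n)_n)`. -/
noncomputable def varDensity (M : Model N dX dY) (g : Experts C dY → ℝ) (r : Latent N C → ℝ)
    (S : Matrix (Fin dX) (Fin dX) ℝ) (θ : Param C dX dY) (w : Latent N C) : ℝ :=
  wishartPDF S M.η₀ (symMat θ.1) * g θ.2 * r w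

/-- The integrand `q log (p / q)` of the evidence lower bound. -/
noncomputable def elboIntegrand (M : Model N dX dY) (q : Param C dX dY → Latent N C → ℝ)
    (w : Latent N C) (θ : Param C dX dY) : ℝ :=
  q θ w * Real.log (pseudoJoint M θ w / q θ w)

/-- The expectation defining the evidence lower bound converges absolutely. -/
def ELBOFinite (M : Model N dX dY) (q : Param C dX dY → Latent N C → ℝ) : Prop :=
  ∀ w, Integrable (elboIntegrand M q w)

/-- The evidence lower bound `E^q log (p / q)`, the expectation being over all hidden variables. -/
noncomputable def elbo (M : Model N dX dY) (q : Param C dX dY → Latent N C → ℝ) : ℝ :=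
  ∑ w, ∫ θ, elboIntegrand M q w θ

/-- `ω_{c,nn'} = q(z^n = c, u^n = n')` -/
noncomputable def omega (r : Latent N C → ℝ) (c : Fin C) (n : Fin N)
    (n' : {n' : Fin N // n' ≠ n}) : ℝ :=
  ∑ w : Latent N C, if w n = (n', c) then r w else 0

/-- `Ω_{nn'} = ∑_c ω_{c,nn'}` -/
noncomputable def bigOmega (r : Latent N C → ℝ) (n : Fin N) (n' : {n' : Fin N // n' ≠ n}) : ℝ :=
  ∑ c : Fin C, omega r c n n'

end

/-! ### Cholesky factors, Bartlett variables and the objective -/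

/-- Cholesky factors: lower triangular matrices with positive diagonal. -/
def choleskyFactors (d : ℕ) : Set (Matrix (Fin d) (Fin d) ℝ) :=
  {L | (∀ i j, i < j → L i j = 0) ∧ ∀ i, 0 < L i i}

/-- The chi-squared distribution with `k` degrees of freedom: the gamma distribution with shape
`k / 2` and rate `1 / 2`. -/
noncomputable def chiSquared (k : ℝ) : Measure ℝ := gammaMeasure (k / 2) (1 / 2)

/-- `A` is a lower triangular random matrix with independent entries, standard normal below the
diagonal and with `A_{ii}² ∼ χ²_{ν + 1 - i}`, `i = 1, …, d`, on it (here indices start at `0`). -/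
structure IsBartlett {Ω : Type*} [MeasurableSpace Ω] (P : Measure Ω) {d : ℕ} (ν : ℝ)
    (A : Ω → Matrix (Fin d) (Fin d) ℝ) : Prop where
  aemeasurable : ∀ i j, AEMeasurable (fun ω => A ω i j) P
  lower : ∀ ω i j, i < j → A ω i j = 0
  indep : iIndepFun (fun (p : Fin d × Fin d) ω => A ω p.1 p.2) P
  diag : ∀ i, HasLaw (fun ω => A ω i i ^ 2) (chiSquared (ν - ((i : ℕ) : ℝ))) P
  offDiag : ∀ i j, j < i → HasLaw (fun ω => A ω i j) (gaussianReal 0 1) P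

section

variable {N C dX dY : ℕ}

/-- `log ∑_{n' ≠ n} exp (-½ (x^n - x^{n'})ᵀ L A Aᵀ Lᵀ (x^n - x^{n'}))` -/
noncomputable def logSumSim (M : Model N dX dY) (n : Fin N)
    (L A : Matrix (Fin dX) (Fin dX) ℝ) : ℝ :=
  Real.log (∑ n' : {n' : Fin N // n' ≠ n},
    Real.exp (-(1 / 2) * ((M.x n - M.x n') ⬝ᵥ ((L * A * Aᵀ * Lᵀ) *ᵥ (M.x n - M.x n')))))

/-- `Λ₀⁻¹ + ∑_n ∑_{n' ≠ n} Ω_{nn'} (x^n - x^{n'}) (x^n - x^{n'})ᵀ` -/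
noncomputable def scatter (M : Model N dX dY) (r : Latent N C → ℝ) :
    Matrix (Fin dX) (Fin dX) ℝ :=
  M.Λ₀⁻¹ + ∑ n : Fin N, ∑ n' : {n' : Fin N // n' ≠ n},
    bigOmega r n n' • Matrix.vecMulVec (M.x n - M.x n') (M.x n - M.x n')

/-- The objective
`-η₀ log det L + ∑_n E log ∑_{n' ≠ n} exp (…) + (η₀ / 2) tr (Lᵀ (Λ₀⁻¹ + …) L)`. -/
noncomputable def objective (M : Model N dX dY) (r : Latent N C → ℝ)
    {Ω : Type*} [MeasurableSpace Ω] (P : Measure Ω) (A : Ω → Matrix (Fin dX) (Fin dX) ℝ)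
    (L : Matrix (Fin dX) (Fin dX) ℝ) : ℝ :=
  -M.η₀ * Real.log L.det + ∑ n : Fin N, ∫ ω, logSumSim M n L (A ω) ∂P +
    M.η₀ / 2 * (Lᵀ * scatter M r * L).trace

end

end SimMoE

/-!
In Cholesky coordinates the Wishart density factorizes. The map `T ↦ (L T) (L T)ᵀ` is a bijection
from the lower triangular matrices with positive diagonal onto the positive definite matrices, and
when index pairs are ordered by column first its derivative is triangular, so that the Jacobian is a
monomial in the diagonal entries (`det_bartlettDeriv`). Multiplied by this Jacobian, the density
`W(· ∣ L Lᵀ, ν)` becomes a product of chi densities (diagonal) and standard normal densities (below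
the diagonal), which no longer involves `L` (`abs_det_bartlettDeriv_mul_wishartPDF`). Therefore
`L A Aᵀ Lᵀ` has the Wishart distribution with scale matrix `L Lᵀ`
(`IsBartlett.map_eq_wishartMeasure`). Only the squares of the diagonal entries of `A` have a
prescribed law, so their signs are arbitrary; changing the signs of the columns of `A` leaves
`A Aᵀ` alone and preserves the independence and the symmetric laws of the other entries
(`measurePreserving_flipCols`).

In `log (p / q_S)` the terms with `log det Λ` cancel, because the prior and the variational factor
have the same degrees of freedom. What is left is a function of `Λ` of at most linear growth,
`gateLog`, plus a function of the other variables, `expertLog`. The first is integrable for every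
`S`, and `E[L A Aᵀ Lᵀ] = η₀ L Lᵀ` evaluates all of it except the expected log-sum-exp terms
(`IsBartlett.integral_gateLog`). The expectation of the second does not depend on `S`, and it is
finite because the evidence lower bound is finite at the current iterate
(`IsBartlett.integrable_expertLog`). This gives `ELBO = K - J` (`IsBartlett.elbo_eq`).

For the minimum, log-sum-exp dominates every weighted average of its arguments. With the weights
`Ω_{nn'}` this bounds the expected log-sum-exp terms from below by exactly minus the data part of
the trace term, so that `J(L) ≥ -η₀ log det L + (η₀ / 2) tr (Lᵀ Λ₀⁻¹ L)`
(`IsBartlett.le_objective`). The right-hand side tends to infinity at infinity and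
at the boundary of the set of Cholesky factors, and `J` is continuous by dominated convergence.
-/

namespace SimMoE

/-! ### Cholesky factors -/

section Cholesky

variable {d : ℕ}

lemma one_mem_choleskyFactors (d : ℕ) : (1 : Matrix (Fin d) (Fin d) ℝ) ∈ choleskyFactors d :=
  ⟨fun _ _ hij => Matrix.one_apply_ne hij.ne, fun i => by simp⟩

lemma det_of_lower {L : Matrix (Fin d) (Fin d) ℝ} (hL : ∀ i j, i < j → L i j = 0) :
    L.det = ∏ i, L i i :=
  Matrix.det_of_isLowerTriangular L fun i j hij => hL i j hij

lemma det_pos_of_mem_choleskyFactors {L : Matrix (Fin d) (Fin d) ℝ}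
    (hL : L ∈ choleskyFactors d) : 0 < L.det := by
  rw [det_of_lower hL.1]
  exact Finset.prod_pos fun i _ => hL.2 i

lemma mul_mem_choleskyFactors {L T : Matrix (Fin d) (Fin d) ℝ}
    (hL : L ∈ choleskyFactors d) (hT : T ∈ choleskyFactors d) : L * T ∈ choleskyFactors d := by
  refine ⟨fun i j hij => ?_, fun i => ?_⟩
  · rw [Matrix.mul_apply]
    refine Finset.sum_eq_zero fun k _ => ?_
    rcases lt_or_ge i k with h | h
    · rw [hL.1 i k h, zero_mul]
    · rw [hT.1 k j (h.trans_lt hij), mul_zero]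
  · rw [Matrix.mul_apply, Finset.sum_eq_single i]
    · exact mul_pos (hL.2 i) (hT.2 i)
    · intro k _ hk
      rcases lt_or_gt_of_ne hk with h | h
      · rw [hT.1 k i h, mul_zero]
      · rw [hL.1 i k h, zero_mul]
    · simp

lemma posDef_mul_transpose {L : Matrix (Fin d) (Fin d) ℝ} (hL : L ∈ choleskyFactors d) :
    (L * Lᵀ).PosDef := by
  have hu : IsUnit L := by
    rw [Matrix.isUnit_iff_isUnit_det]
    exact (det_pos_of_mem_choleskyFactors hL).ne'.isUnit
  have := Matrix.PosDef.mul_conjTranspose_self L (Matrix.vecMul_injective_of_isUnit hu)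
  rwa [Matrix.conjTranspose_eq_transpose_of_trivial] at this

/-- The entries of `L Lᵀ` on and below the diagonal determine the Cholesky factor `L`, column by
column. -/
lemma choleskyFactors_ext {L T : Matrix (Fin d) (Fin d) ℝ}
    (hL : L ∈ choleskyFactors d) (hT : T ∈ choleskyFactors d)
    (h : ∀ i j, j ≤ i → (L * Lᵀ) i j = (T * Tᵀ) i j) : L = T := by
  have entry : ∀ {M : Matrix (Fin d) (Fin d) ℝ}, M ∈ choleskyFactors d → ∀ i j,
      (M * Mᵀ) i j = ∑ k ∈ Finset.Iio j, M i k * M j k + M i j * M j j := by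
    intro M hM i j
    rw [Matrix.mul_apply, ← Finset.sum_subset (Finset.subset_univ (Finset.Iic j)),
      ← Finset.Iio_insert, Finset.sum_insert (by simp), add_comm]
    · rfl
    · intro k _ hk
      rw [Matrix.transpose_apply, hM.1 j k (by simpa using hk), mul_zero]
  have key : ∀ j : Fin d, ∀ i, L i j = T i j := by
    intro j
    induction j using WellFoundedLT.induction with
    | ind j ih =>
      have hsum : ∀ i, ∑ k ∈ Finset.Iio j, L i k * L j k = ∑ k ∈ Finset.Iio j, T i k * T j k :=
        fun i => Finset.sum_congr rfl fun k hk => by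
          rw [ih k (by simpa using hk) i, ih k (by simpa using hk) j]
      have hprod : ∀ i, j ≤ i → L i j * L j j = T i j * T j j := by
        intro i hij
        have := h i j hij
        rw [entry hL, entry hT, hsum i] at this
        exact add_left_cancel this
      have hdiag : L j j = T j j := by
        have := hprod j le_rfl
        exact (mul_self_inj (hL.2 j).le (hT.2 j).le).mp this
      intro i
      rcases lt_or_ge i j with hij | hij
      · rw [hL.1 i j hij, hT.1 i j hij]
      · have := hprod i hij
        rw [hdiag] at this
        exact mul_right_cancel₀ (hT.2 j).ne' this
  ext i j
  exact key j i

/-- The triangular factor of the LDL decomposition, with its columns rescaled by the square roots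
of the diagonal factor and their signs normalized, is a Cholesky factor. -/
lemma exists_cholesky {S : Matrix (Fin d) (Fin d) ℝ} (hS : S.PosDef) :
    ∃ L ∈ choleskyFactors d, S = L * Lᵀ := by
  set U := LDL.lower hS with hU
  set e : Fin d → ℝ := LDL.diagEntries hS with he
  have hWlow : (LDL.lowerInv hS).BlockTriangular OrderDual.toDual :=
    fun i j hij => LDL.lowerInv_triangular hS hij
  have hUlow : ∀ i j, i < j → U i j = 0 := by
    intro i j hij
    exact Matrix.blockTriangular_inv_of_blockTriangular hWlow hij
  have hWunit : IsUnit (LDL.lowerInv hS) := isUnit_of_invertible _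
  have hUdet : U.det ≠ 0 := by
    have := (Matrix.isUnit_nonsing_inv_iff.mpr hWunit)
    rw [Matrix.isUnit_iff_isUnit_det] at this
    exact this.ne_zero
  have hUdiag : ∀ i, U i i ≠ 0 := by
    rw [det_of_lower hUlow, Finset.prod_ne_zero_iff] at hUdet
    exact fun i => hUdet i (Finset.mem_univ i)
  have hepos : ∀ i, 0 < e i := by
    have h1 : (LDL.diag hS).PosDef := by
      rw [LDL.diag_eq_lowerInv_conj]
      exact hS.mul_mul_conjTranspose_same (Matrix.vecMul_injective_of_isUnit hWunit)
    exact Matrix.posDef_diagonal_iff.mp h1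
  set c : Fin d → ℝ := fun i => SignType.sign (U i i) * √(e i) with hc
  have hcc : ∀ i, c i * c i = e i := by
    intro i
    have h1 : ((SignType.sign (U i i) : SignType) : ℝ) *
        (SignType.sign (U i i) : SignType) = 1 := by
      rcases lt_or_gt_of_ne (hUdiag i) with h | h <;> simp [h]
    calc c i * c i = ((SignType.sign (U i i) : SignType) : ℝ) * (SignType.sign (U i i) : SignType)
          * (√(e i) * √(e i)) := by simp only [hc]; ring
      _ = e i := by rw [h1, Real.mul_self_sqrt (hepos i).le, one_mul]
  refine ⟨U * Matrix.diagonal c, ⟨fun i j hij => ?_, fun i => ?_⟩, ?_⟩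
  · rw [Matrix.mul_diagonal, hUlow i j hij, zero_mul]
  · rw [Matrix.mul_diagonal]
    have h1 : 0 < U i i * (SignType.sign (U i i) : SignType) := by
      rw [mul_comm, sign_mul_self]
      exact abs_pos.mpr (hUdiag i)
    rw [hc, ← mul_assoc]
    exact mul_pos h1 (Real.sqrt_pos.mpr (hepos i))
  · have h1 := LDL.lower_conj_diag hS
    rw [Matrix.conjTranspose_eq_transpose_of_trivial] at h1
    rw [Matrix.transpose_mul, Matrix.diagonal_transpose, Matrix.mul_assoc,
      ← Matrix.mul_assoc (Matrix.diagonal c), Matrix.diagonal_mul_diagonal]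
    simp_rw [hcc]
    rw [← Matrix.mul_assoc]
    exact h1.symm

lemma existsUnique_cholesky {S : Matrix (Fin d) (Fin d) ℝ} (hS : S.PosDef) :
    ∃! L, L ∈ choleskyFactors d ∧ S = L * Lᵀ := by
  obtain ⟨L, hL, h⟩ := exists_cholesky hS
  refine ⟨L, ⟨hL, h⟩, fun T hT => ?_⟩
  exact choleskyFactors_ext hT.1 hL fun i j _ => by rw [← h, ← hT.2]

end Cholesky

/-! ### Coordinates of symmetric and of lower triangular matrices -/

section Coordinates

variable {d : ℕ}

/-- The entries of a matrix on and below the diagonal. -/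
def symCoord {d : ℕ} (X : Matrix (Fin d) (Fin d) ℝ) : SymCoord d := fun p => X p.1.1 p.1.2

/-- The lower triangular matrix with given entries on and below the diagonal. -/
def lowMat {d : ℕ} (v : SymCoord d) : Matrix (Fin d) (Fin d) ℝ :=
  Matrix.of fun i j => if h : j ≤ i then v ⟨(i, j), h⟩ else 0

/-- Coordinates of the Cholesky factors among those of the lower triangular matrices. -/
def posDiag (d : ℕ) : Set (SymCoord d) := {v | ∀ i, 0 < v ⟨(i, i), le_rfl⟩}

lemma symMat_symCoord {X : Matrix (Fin d) (Fin d) ℝ} (hX : X.IsSymm) :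
    symMat (symCoord X) = X := by
  ext i j
  simp only [symMat, symCoord, Matrix.of_apply]
  split_ifs
  · rfl
  · exact hX.apply i j

lemma symCoord_symMat (v : SymCoord d) : symCoord (symMat v) = v := by
  ext ⟨p, hp⟩
  simp [symMat, symCoord, hp]

lemma lowMat_apply_of_le (v : SymCoord d) {i j : Fin d} (h : j ≤ i) :
    lowMat v i j = v ⟨(i, j), h⟩ := by
  simp [lowMat, h]

lemma lowMat_apply_of_lt (v : SymCoord d) {i j : Fin d} (h : i < j) : lowMat v i j = 0 := by
  simp [lowMat, h.not_ge]

lemma lowMat_symCoord {L : Matrix (Fin d) (Fin d) ℝ} (hL : ∀ i j, i < j → L i j = 0) :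
    lowMat (symCoord L) = L := by
  ext i j
  rcases lt_or_ge i j with h | h
  · rw [lowMat_apply_of_lt _ h, hL i j h]
  · rw [lowMat_apply_of_le _ h, symCoord]

lemma symCoord_lowMat (v : SymCoord d) : symCoord (lowMat v) = v := by
  ext ⟨p, hp⟩
  simp [lowMat, symCoord, hp]

lemma lowMat_mem_choleskyFactors {v : SymCoord d} (hv : v ∈ posDiag d) :
    lowMat v ∈ choleskyFactors d :=
  ⟨fun _ _ h => lowMat_apply_of_lt v h, fun i => by rw [lowMat_apply_of_le v le_rfl]; exact hv i⟩

lemma symCoord_mem_posDiag {L : Matrix (Fin d) (Fin d) ℝ} (hL : L ∈ choleskyFactors d) :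
    symCoord L ∈ posDiag d := fun i => hL.2 i

lemma isOpen_posDiag (d : ℕ) : IsOpen (posDiag d) := by
  have : posDiag d = ⋂ i : Fin d, {v : SymCoord d | 0 < v ⟨(i, i), le_rfl⟩} := by
    ext v; simp [posDiag]
  rw [this]
  exact isOpen_iInter_of_finite fun i => isOpen_lt continuous_const (continuous_apply _)

lemma lowMat_add (v w : SymCoord d) : lowMat (v + w) = lowMat v + lowMat w := by
  ext i j
  by_cases h : j ≤ i <;> simp [lowMat, h]

lemma lowMat_smul (c : ℝ) (v : SymCoord d) : lowMat (c • v) = c • lowMat v := by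
  ext i j
  by_cases h : j ≤ i <;> simp [lowMat, h]

lemma symCoord_add (X Y : Matrix (Fin d) (Fin d) ℝ) :
    symCoord (X + Y) = symCoord X + symCoord Y := rfl

lemma symCoord_smul (c : ℝ) (X : Matrix (Fin d) (Fin d) ℝ) :
    symCoord (c • X) = c • symCoord X := rfl

lemma continuous_symMat : Continuous (symMat : SymCoord d → Matrix (Fin d) (Fin d) ℝ) := by
  refine continuous_matrix fun i j => ?_
  by_cases h : j ≤ i
  · simp only [symMat, Matrix.of_apply, h, dite_true]; fun_prop
  · simp only [symMat, Matrix.of_apply, h, dite_false]; fun_prop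

end Coordinates

/-! ### The Jacobian of `T ↦ (L T) (L T)ᵀ` on lower triangular matrices -/

section Jacobian

variable {d : ℕ}

/-- A matrix that is triangular for the order pulled back along an injection has as determinant
the product of its diagonal. -/
lemma det_of_blockTriangular_injective {ι α : Type*} [Fintype ι] [DecidableEq ι] [LinearOrder α]
    {M : Matrix ι ι ℝ} {b : ι → α} (hb : Function.Injective b) (hM : M.BlockTriangular b) :
    M.det = ∏ i, M i i := by
  let _ : LinearOrder ι := LinearOrder.lift' b hb
  have h : M.IsUpperTriangular := fun i j hij => hM hij
  convert Matrix.det_of_isUpperTriangular h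

/-- The order on the index pairs `(i, j)` that compares first columns, then rows. -/
def colRow (p : {p : Fin d × Fin d // p.2 ≤ p.1}) : Fin d ×ₗ Fin d := toLex (p.1.2, p.1.1)

lemma colRow_injective : Function.Injective (colRow (d := d)) := by
  rintro ⟨⟨i, j⟩, h⟩ ⟨⟨k, l⟩, h'⟩ heq
  simp only [colRow, EmbeddingLike.apply_eq_iff_eq, Prod.mk.injEq] at heq
  simp [heq.1, heq.2]

lemma colRow_lt {p q : {p : Fin d × Fin d // p.2 ≤ p.1}} :
    colRow p < colRow q ↔ p.1.2 < q.1.2 ∨ p.1.2 = q.1.2 ∧ p.1.1 < q.1.1 := by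
  rw [colRow, colRow, Prod.Lex.toLex_lt_toLex]

/-- A linear map of coordinate vectors is triangular, and its determinant is the product of its
diagonal coefficients, once the image of a basis vector vanishes at all earlier index pairs. -/
lemma det_of_triangular (f : SymCoord d →ₗ[ℝ] SymCoord d)
    (hf : ∀ p q, colRow p < colRow q → f (Pi.single q 1) p = 0) :
    LinearMap.det f = ∏ p, f (Pi.single p 1) p := by
  rw [← LinearMap.det_toMatrix']
  have h : (LinearMap.toMatrix' f)ᵀ.BlockTriangular colRow := by
    intro p q hpq
    rw [Matrix.transpose_apply, LinearMap.toMatrix'_apply]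
    convert hf q p hpq using 2
  rw [← Matrix.det_transpose, det_of_blockTriangular_injective colRow_injective h]
  refine Finset.prod_congr rfl fun p _ => ?_
  rw [Matrix.transpose_apply, LinearMap.toMatrix'_apply]

lemma lowMat_single (q : {p : Fin d × Fin d // p.2 ≤ p.1}) (i j : Fin d) :
    lowMat (Pi.single q 1) i j = if i = q.1.1 ∧ j = q.1.2 then 1 else 0 := by
  rcases lt_or_ge i j with h | h
  · rw [lowMat_apply_of_lt _ h, if_neg]
    rintro ⟨rfl, rfl⟩
    exact absurd q.2 h.not_ge
  · rw [lowMat_apply_of_le _ h, Pi.single_apply]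
    congr 1
    rw [Subtype.ext_iff, Prod.ext_iff]

/-- The map `T ↦ L T` on lower triangular matrices. -/
def mulLow (L : Matrix (Fin d) (Fin d) ℝ) : SymCoord d →ₗ[ℝ] SymCoord d where
  toFun v := symCoord (L * lowMat v)
  map_add' v w := by rw [lowMat_add, Matrix.mul_add, symCoord_add]
  map_smul' c v := by rw [lowMat_smul, Matrix.mul_smul, symCoord_smul]; rfl

lemma mulLow_apply (L : Matrix (Fin d) (Fin d) ℝ) (v : SymCoord d) :
    mulLow L v = symCoord (L * lowMat v) := rfl

lemma lowMat_mulLow {L : Matrix (Fin d) (Fin d) ℝ} (hL : ∀ i j, i < j → L i j = 0)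
    (v : SymCoord d) : lowMat (mulLow L v) = L * lowMat v := by
  refine lowMat_symCoord (L := L * lowMat v) fun i j hij => ?_
  rw [Matrix.mul_apply]
  refine Finset.sum_eq_zero fun k _ => ?_
  rcases lt_or_ge i k with h | h
  · rw [hL i k h, zero_mul]
  · rw [lowMat_apply_of_lt v (h.trans_lt hij), mul_zero]

lemma det_mulLow {L : Matrix (Fin d) (Fin d) ℝ} (hL : ∀ i j, i < j → L i j = 0) :
    LinearMap.det (mulLow L) = ∏ p : {p : Fin d × Fin d // p.2 ≤ p.1}, L p.1.1 p.1.1 := by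
  have entry : ∀ p q : {p : Fin d × Fin d // p.2 ≤ p.1},
      mulLow L (Pi.single q 1) p = if p.1.2 = q.1.2 then L p.1.1 q.1.1 else 0 := by
    intro p q
    simp only [mulLow_apply, symCoord, Matrix.mul_apply, lowMat_single]
    split_ifs with h <;> simp [h]
  rw [det_of_triangular]
  · exact Finset.prod_congr rfl fun p _ => by rw [entry, if_pos rfl]
  · intro p q hpq
    rw [entry]
    rcases colRow_lt.mp hpq with h | ⟨h, h'⟩
    · rw [if_neg h.ne]
    · rw [if_pos h, hL _ _ h']

/-- The map `T ↦ T Tᵀ` from lower triangular to symmetric matrices. -/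
def gram (v : SymCoord d) : SymCoord d := symCoord (lowMat v * (lowMat v)ᵀ)

/-- The derivative `H ↦ T Hᵀ + H Tᵀ` of `T ↦ T Tᵀ`. -/
def gramDeriv (v : SymCoord d) : SymCoord d →ₗ[ℝ] SymCoord d where
  toFun h := symCoord (lowMat v * (lowMat h)ᵀ + lowMat h * (lowMat v)ᵀ)
  map_add' h k := by
    simp only [lowMat_add, Matrix.transpose_add, Matrix.mul_add, Matrix.add_mul, symCoord_add]
    abel
  map_smul' c h := by
    simp only [lowMat_smul, Matrix.transpose_smul, Matrix.mul_smul, Matrix.smul_mul, symCoord_add,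
      symCoord_smul, smul_add, RingHom.id_apply]

lemma gramDeriv_apply (v h : SymCoord d) (p : {p : Fin d × Fin d // p.2 ≤ p.1}) :
    gramDeriv v h p = ∑ k, lowMat v p.1.1 k * lowMat h p.1.2 k +
      ∑ k, lowMat h p.1.1 k * lowMat v p.1.2 k := rfl

/-- In the column-first order the derivative is triangular: the entry `(i, j)`, `j ≤ i`, of
`T Hᵀ + H Tᵀ` involves only columns `k ≤ j` of `H`, and of the column `j` only `H_{ij}` and
`H_{jj}`. -/
lemma det_gramDeriv (v : SymCoord d) :
    LinearMap.det (gramDeriv v) = ∏ p : {p : Fin d × Fin d // p.2 ≤ p.1},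
      ((if p.1.1 = p.1.2 then 2 else 1) * v ⟨(p.1.2, p.1.2), le_rfl⟩) := by
  have entry : ∀ p q : {p : Fin d × Fin d // p.2 ≤ p.1}, gramDeriv v (Pi.single q 1) p =
      (if p.1.2 = q.1.1 then lowMat v p.1.1 q.1.2 else 0) +
        (if p.1.1 = q.1.1 then lowMat v p.1.2 q.1.2 else 0) := by
    intro p q
    rw [gramDeriv_apply]
    simp only [lowMat_single]
    congr 1
    · split_ifs with h <;> simp [h]
    · split_ifs with h <;> simp [h]
  rw [det_of_triangular]
  · refine Finset.prod_congr rfl fun p _ => ?_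
    rw [entry, if_pos rfl]
    rcases eq_or_ne p.1.1 p.1.2 with h | h
    · rw [if_pos h.symm, if_pos h, h, lowMat_apply_of_le v le_rfl]; ring
    · rw [if_neg h.symm, if_neg h, lowMat_apply_of_le v le_rfl]; ring
  · intro p q hpq
    rw [entry]
    have hp := p.2
    have hq := q.2
    rcases colRow_lt.mp hpq with h | ⟨h, h'⟩
    · rw [if_neg (h.trans_le hq).ne, lowMat_apply_of_lt v h, ite_self, add_zero]
    · rw [if_neg (hp.trans_lt h').ne, if_neg h'.ne, add_zero]

lemma hasFDerivAt_gram (v : SymCoord d) :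
    HasFDerivAt gram (LinearMap.toContinuousLinearMap (gramDeriv v)) v := by
  have hlow : ∀ i j : Fin d, ∃ ℓ : SymCoord d →L[ℝ] ℝ, ∀ h, ℓ h = lowMat h i j := fun i j =>
    ⟨LinearMap.toContinuousLinearMap
      { toFun := fun h => lowMat h i j
        map_add' := fun h k => by rw [lowMat_add]; rfl
        map_smul' := fun c h => by rw [lowMat_smul]; rfl }, fun h => rfl⟩
  choose ℓ hℓ using hlow
  rw [hasFDerivAt_pi']
  intro p
  have h1 : HasFDerivAt (fun v : SymCoord d => ∑ k, ℓ p.1.1 k v * ℓ p.1.2 k v)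
      (∑ k, (ℓ p.1.1 k v • ℓ p.1.2 k + ℓ p.1.2 k v • ℓ p.1.1 k)) v :=
    HasFDerivAt.fun_sum fun k _ => (ℓ p.1.1 k).hasFDerivAt.mul (ℓ p.1.2 k).hasFDerivAt
  have hfun : (fun w => gram w p) = fun w : SymCoord d => ∑ k, ℓ p.1.1 k w * ℓ p.1.2 k w := by
    funext w
    simp only [hℓ]
    rfl
  rw [hfun]
  refine h1.congr_fderiv ?_
  ext1 h
  have e1 : (∑ k, (ℓ p.1.1 k v • ℓ p.1.2 k + ℓ p.1.2 k v • ℓ p.1.1 k)) h = gramDeriv v h p := by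
    simp only [gramDeriv_apply, sum_apply, add_apply, smul_apply, hℓ, smul_eq_mul,
      Finset.sum_add_distrib]
    congr 1
    exact Finset.sum_congr rfl fun k _ => mul_comm _ _
  exact e1

end Jacobian

/-! ### The joint law of the Bartlett variables -/

section Law

/-- Density of the chi distribution with `k` degrees of freedom, the law of `√X` for `X ∼ χ²_k`. -/
noncomputable def chiPDF (k t : ℝ) : ℝ :=
  if 0 < t then 2 * ((1 / 2) ^ (k / 2) / Real.Gamma (k / 2)) * t ^ (k - 1) * Real.exp (-(t ^ 2 / 2))
  else 0

lemma measurable_chiPDF (k : ℝ) : Measurable (chiPDF k) :=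
  Measurable.ite measurableSet_Ioi (by fun_prop) measurable_const

lemma chiPDF_nonneg {k : ℝ} (hk : 0 < k) (t : ℝ) : 0 ≤ chiPDF k t := by
  have := Real.Gamma_pos_of_pos (half_pos hk)
  unfold chiPDF
  split_ifs <;> positivity

lemma chiSquared_map_sqrt (k : ℝ) :
    (chiSquared k).map Real.sqrt = volume.withDensity fun t => ENNReal.ofReal (chiPDF k t) := by
  classical
  have hsqrt : Measurable Real.sqrt := Real.continuous_sqrt.measurable
  have himg : (fun t : ℝ => t ^ 2) '' Set.Ioi 0 = Set.Ioi 0 := by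
    ext x
    constructor
    · rintro ⟨t, ht, rfl⟩
      exact pow_pos (Set.mem_Ioi.mp ht) 2
    · intro hx
      exact ⟨√x, Real.sqrt_pos.mpr hx, Real.sq_sqrt (le_of_lt hx)⟩
  have hinj : Set.InjOn (fun t : ℝ => t ^ 2) (Set.Ioi 0) := fun a ha b hb hab =>
    (pow_left_inj₀ (le_of_lt ha) (le_of_lt hb) two_ne_zero).mp hab
  ext s hs
  rw [Measure.map_apply hsqrt hs, chiSquared, gammaMeasure,
    withDensity_apply _ (hsqrt hs), withDensity_apply _ hs, ← lintegral_indicator (hsqrt hs),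
    ← lintegral_indicator hs]
  -- both integrands vanish on the negative half-line, and the origin is negligible
  have h1 : ∫⁻ x, (Real.sqrt ⁻¹' s).indicator (gammaPDF (k / 2) (1 / 2)) x =
      ∫⁻ x in Set.Ioi 0, (Real.sqrt ⁻¹' s).indicator (gammaPDF (k / 2) (1 / 2)) x := by
    rw [setLIntegral_congr Ioi_ae_eq_Ici, ← lintegral_indicator measurableSet_Ici]
    congr 1 with x
    by_cases hx : 0 ≤ x
    · rw [Set.indicator_of_mem (Set.mem_Ici.mpr hx)]
    · rw [Set.indicator_of_notMem (s := Set.Ici 0) (by simpa using hx), Set.indicator_apply,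
        gammaPDF_of_neg (not_le.mp hx), ite_self]
  have h2 : ∫⁻ x, s.indicator (fun t => ENNReal.ofReal (chiPDF k t)) x =
      ∫⁻ x in Set.Ioi 0, s.indicator (fun t => ENNReal.ofReal (chiPDF k t)) x := by
    rw [← lintegral_indicator measurableSet_Ioi]
    congr 1 with x
    by_cases hx : 0 < x
    · rw [Set.indicator_of_mem (Set.mem_Ioi.mpr hx)]
    · rw [Set.indicator_of_notMem (s := Set.Ioi 0) (by simpa using hx), Set.indicator_apply, chiPDF,
        if_neg hx, ENNReal.ofReal_zero, ite_self]
  rw [h1, h2, ← himg, lintegral_image_eq_lintegral_abs_deriv_mul measurableSet_Ioi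
    (fun t _ => (hasDerivAt_pow 2 t).hasDerivWithinAt) hinj, himg]
  refine setLIntegral_congr_fun measurableSet_Ioi fun t ht => ?_
  have ht : 0 < t := ht
  simp only [Set.indicator_apply, Set.mem_preimage, Real.sqrt_sq ht.le]
  split_ifs
  · rw [gammaPDF_of_nonneg (by positivity), ← ENNReal.ofReal_mul (abs_nonneg _), chiPDF, if_pos ht]
    congr 1
    have hpow : (t ^ 2) ^ (k / 2 - 1) * t = t ^ (k - 1) := by
      rw [← Real.rpow_natCast, ← Real.rpow_mul ht.le]
      nth_rw 2 [← Real.rpow_one t]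
      rw [← Real.rpow_add ht]
      congr 1
      push_cast
      ring
    rw [abs_of_pos (by positivity), ← hpow]
    push_cast
    ring_nf
  · simp

lemma isProbabilityMeasure_chiSquared_map_sqrt {k : ℝ} (hk : 0 < k) :
    IsProbabilityMeasure ((chiSquared k).map Real.sqrt) := by
  have : IsProbabilityMeasure (chiSquared k) :=
    isProbabilityMeasure_gammaMeasure (half_pos hk) (by norm_num)
  exact Measure.isProbabilityMeasure_map Real.continuous_sqrt.measurable.aemeasurable

/-- A product of measures with integrable densities has the product density. -/
lemma pi_withDensity {ι : Type*} [Fintype ι] (f : ι → ℝ → ℝ) (hf : ∀ i, Integrable (f i))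
    (h0 : ∀ i t, 0 ≤ f i t) :
    Measure.pi (fun i => volume.withDensity fun t => ENNReal.ofReal (f i t)) =
      (volume : Measure (ι → ℝ)).withDensity fun x => ENNReal.ofReal (∏ i, f i (x i)) := by
  have : ∀ i, IsFiniteMeasure (volume.withDensity fun t => ENNReal.ofReal (f i t)) := fun i =>
    isFiniteMeasure_withDensity_ofReal (hf i).2
  refine Measure.pi_eq fun s hs => ?_
  have hind : ∀ i, Integrable ((s i).indicator (f i)) := fun i => (hf i).indicator (hs i)
  have hind0 : ∀ i t, 0 ≤ (s i).indicator (f i) t := fun i t =>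
    Set.indicator_nonneg (fun t _ => h0 i t) t
  have hone : ∀ i, (volume.withDensity fun t => ENNReal.ofReal (f i t)) (s i) =
      ENNReal.ofReal (∫ t, (s i).indicator (f i) t) := by
    intro i
    rw [withDensity_apply _ (hs i), integral_indicator (hs i),
      ofReal_integral_eq_lintegral_ofReal (hf i).integrableOn (ae_of_all _ (h0 i))]
  have hprod : ∀ x : ι → ℝ, (Set.univ.pi s).indicator
      (fun x => ENNReal.ofReal (∏ i, f i (x i))) x =
        ENNReal.ofReal (∏ i, (s i).indicator (f i) (x i)) := by
    intro x
    by_cases hx : x ∈ Set.univ.pi s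
    · rw [Set.indicator_of_mem hx]
      congr 1
      exact Finset.prod_congr rfl fun i _ => by rw [Set.indicator_of_mem (hx i trivial)]
    · rw [Set.indicator_of_notMem hx]
      simp only [Set.mem_pi, Set.mem_univ, true_implies, not_forall] at hx
      obtain ⟨i, hi⟩ := hx
      rw [Finset.prod_eq_zero (Finset.mem_univ i) (Set.indicator_of_notMem hi _),
        ENNReal.ofReal_zero]
  rw [withDensity_apply _ (MeasurableSet.univ_pi hs),
    ← lintegral_indicator (MeasurableSet.univ_pi hs)]
  simp_rw [hprod, hone]
  rw [volume_pi, ← ofReal_integral_eq_lintegral_ofReal (Integrable.fintype_prod hind)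
      (ae_of_all _ fun x => Finset.prod_nonneg fun i _ => hind0 i _),
    integral_fintype_prod_eq_prod (fun i => (s i).indicator (f i)),
    ENNReal.ofReal_prod_of_nonneg fun i _ => integral_nonneg (hind0 i)]

/-- Law of the entry `p` of a Bartlett matrix whose diagonal is nonnegative. -/
noncomputable def entryLaw {d : ℕ} (ν : ℝ) (p : {p : Fin d × Fin d // p.2 ≤ p.1}) : Measure ℝ :=
  if p.1.1 = p.1.2 then (chiSquared (ν - ((p.1.1 : ℕ) : ℝ))).map Real.sqrt else gaussianReal 0 1

/-- Density of `entryLaw`. -/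
noncomputable def entryPDF {d : ℕ} (ν : ℝ) (p : {p : Fin d × Fin d // p.2 ≤ p.1}) (t : ℝ) : ℝ :=
  if p.1.1 = p.1.2 then chiPDF (ν - ((p.1.1 : ℕ) : ℝ)) t else gaussianPDFReal 0 1 t

variable {d : ℕ} {ν : ℝ}

lemma sub_natCast_pos (hν : (d : ℝ) - 1 < ν) (i : Fin d) : 0 < ν - ((i : ℕ) : ℝ) := by
  have : ((i : ℕ) : ℝ) + 1 ≤ d := by exact_mod_cast i.2
  linarith

lemma isProbabilityMeasure_entryLaw (hν : (d : ℝ) - 1 < ν)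
    (p : {p : Fin d × Fin d // p.2 ≤ p.1}) : IsProbabilityMeasure (entryLaw ν p) := by
  have := isProbabilityMeasure_chiSquared_map_sqrt (sub_natCast_pos hν p.1.1)
  unfold entryLaw
  split_ifs <;> infer_instance

lemma entryLaw_eq (ν : ℝ) (p : {p : Fin d × Fin d // p.2 ≤ p.1}) :
    entryLaw ν p = volume.withDensity fun t => ENNReal.ofReal (entryPDF ν p t) := by
  by_cases h : p.1.1 = p.1.2
  · simp only [entryLaw, entryPDF, if_pos h, chiSquared_map_sqrt]
  · simp only [entryLaw, entryPDF, if_neg h]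
    rw [gaussianReal_of_var_ne_zero _ one_ne_zero]
    rfl

lemma entryPDF_nonneg (hν : (d : ℝ) - 1 < ν) (p : {p : Fin d × Fin d // p.2 ≤ p.1}) (t : ℝ) :
    0 ≤ entryPDF ν p t := by
  unfold entryPDF
  split_ifs
  · exact chiPDF_nonneg (sub_natCast_pos hν _) t
  · exact gaussianPDFReal_nonneg 0 1 t

lemma measurable_entryPDF (ν : ℝ) (p : {p : Fin d × Fin d // p.2 ≤ p.1}) :
    Measurable (entryPDF ν p) := by
  unfold entryPDF
  split_ifs
  · exact measurable_chiPDF _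
  · exact measurable_gaussianPDFReal 0 1

lemma integrable_entryPDF (hν : (d : ℝ) - 1 < ν) (p : {p : Fin d × Fin d // p.2 ≤ p.1}) :
    Integrable (entryPDF ν p) := by
  refine ⟨(measurable_entryPDF ν p).aestronglyMeasurable, ?_⟩
  rw [hasFiniteIntegral_iff_ofReal (ae_of_all _ (entryPDF_nonneg hν p)), ← setLIntegral_univ,
    ← withDensity_apply _ MeasurableSet.univ, ← entryLaw_eq]
  have := isProbabilityMeasure_entryLaw hν p
  exact measure_lt_top _ _

lemma pi_entryLaw_eq (hν : (d : ℝ) - 1 < ν) :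
    Measure.pi (entryLaw (d := d) ν) =
      (volume : Measure (SymCoord d)).withDensity fun t =>
        ENNReal.ofReal (∏ p, entryPDF ν p (t p)) := by
  rw [← pi_withDensity _ (integrable_entryPDF hν) (entryPDF_nonneg hν)]
  congr 1
  funext p
  exact entryLaw_eq ν p

/-- The sign of `t`, with value `1` at `0`, so that `sgn t * sgn t = 1` without exception. -/
noncomputable def sgn (t : ℝ) : ℝ := if 0 ≤ t then 1 else -1

lemma sgn_mul_self (t : ℝ) : sgn t * sgn t = 1 := by
  unfold sgn; split_ifs <;> norm_num

lemma mul_sgn (t : ℝ) : t * sgn t = |t| := by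
  unfold sgn
  split_ifs with h
  · rw [abs_of_nonneg h, mul_one]
  · rw [abs_of_neg (not_le.mp h), mul_neg_one]

lemma measurable_sgn : Measurable sgn :=
  Measurable.ite measurableSet_Ici measurable_const measurable_const

/-- Changes the signs of the columns of a lower triangular matrix so that its diagonal becomes
nonnegative. -/
noncomputable def flipCols (t : SymCoord d) : SymCoord d :=
  fun p => t p * sgn (t ⟨(p.1.2, p.1.2), le_rfl⟩)

lemma lowMat_flipCols_mul_transpose (t : SymCoord d) :
    lowMat (flipCols t) * (lowMat (flipCols t))ᵀ = lowMat t * (lowMat t)ᵀ := by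
  have h : lowMat (flipCols t) =
      lowMat t * Matrix.diagonal fun j => sgn (t ⟨(j, j), le_rfl⟩) := by
    ext i j
    rw [Matrix.mul_diagonal]
    rcases lt_or_ge i j with h | h
    · rw [lowMat_apply_of_lt _ h, lowMat_apply_of_lt _ h, zero_mul]
    · rw [lowMat_apply_of_le _ h, lowMat_apply_of_le _ h, flipCols]
  rw [h, Matrix.transpose_mul, Matrix.diagonal_transpose, Matrix.mul_assoc,
    ← Matrix.mul_assoc (Matrix.diagonal _), Matrix.diagonal_mul_diagonal]
  simp_rw [sgn_mul_self]
  rw [Matrix.diagonal_one, Matrix.one_mul]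

lemma measurePreserving_mul_sgn (a : ℝ) :
    MeasurePreserving (fun t => t * sgn a) (gaussianReal 0 1) (gaussianReal 0 1) := by
  refine ⟨measurable_id.mul_const _, ?_⟩
  rw [gaussianReal_map_mul_const]
  congr 1
  · simp
  · rw [mul_one, ← NNReal.coe_inj]
    simp [sq, sgn_mul_self]

/-- Given the diagonal, the entries below it are independent and symmetric, so that the flips of
columns do not change their law. -/
lemma measurePreserving_flipCols (hν : (d : ℝ) - 1 < ν)
    (μ : {p : Fin d × Fin d // p.2 ≤ p.1} → Measure ℝ) [∀ p, IsProbabilityMeasure (μ p)]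
    (hdiag : ∀ p, p.1.1 = p.1.2 → (μ p).map abs = entryLaw ν p)
    (hoff : ∀ p, p.1.1 ≠ p.1.2 → μ p = gaussianReal 0 1) :
    MeasurePreserving flipCols (Measure.pi μ) (Measure.pi (entryLaw ν)) := by
  have := isProbabilityMeasure_entryLaw (d := d) hν
  let D : {p : Fin d × Fin d // p.2 ≤ p.1} → Prop := fun p => p.1.1 = p.1.2
  let e := MeasurableEquiv.piEquivPiSubtypeProd (fun _ : {p : Fin d × Fin d // p.2 ≤ p.1} => ℝ) D
  have he := measurePreserving_piEquivPiSubtypeProd μ D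
  have he' := (measurePreserving_piEquivPiSubtypeProd (entryLaw ν) D).symm
  have hf : MeasurePreserving (fun (a : Subtype D → ℝ) q => |a q|)
      (Measure.pi fun q : Subtype D => μ q) (Measure.pi fun q : Subtype D => entryLaw ν q.1) :=
    measurePreserving_pi (fun q : Subtype D => μ q) (fun q : Subtype D => entryLaw ν q.1)
      fun q => ⟨continuous_abs.measurable, hdiag q q.2⟩
  have hskew := hf.skew_product
    (g := fun a (c : {p // ¬ D p} → ℝ) q => c q * sgn (a ⟨⟨(q.1.1.2, q.1.1.2), le_rfl⟩, rfl⟩))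
    (μc := Measure.pi fun q : {p // ¬ D p} => μ q)
    (μd := Measure.pi fun q : {p // ¬ D p} => entryLaw ν q.1)
    (by
      refine measurable_pi_lambda _ fun q => ?_
      exact ((measurable_pi_apply q).comp measurable_snd).mul
        (measurable_sgn.comp ((measurable_pi_apply _).comp measurable_fst)))
    (ae_of_all _ fun a => by
      refine (measurePreserving_pi (fun q : {p // ¬ D p} => μ q)
        (fun q : {p // ¬ D p} => entryLaw ν q.1)
        (f := fun q t => t * sgn (a ⟨⟨(q.1.1.2, q.1.1.2), le_rfl⟩, rfl⟩)) fun q => ?_).map_eq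
      rw [hoff q q.2, show entryLaw ν q.1 = gaussianReal 0 1 from if_neg q.2]
      exact measurePreserving_mul_sgn _)
  have hcomp := he'.comp (hskew.comp he)
  convert hcomp using 1
  funext t
  ext p
  by_cases hp : D p
  · have hp' : p.1.2 = p.1.1 := Eq.symm hp
    have : (⟨(p.1.2, p.1.2), le_rfl⟩ : {p : Fin d × Fin d // p.2 ≤ p.1}) = p :=
      Subtype.ext (Prod.ext hp' rfl)
    simp only [flipCols, this, mul_sgn]
    simp [MeasurableEquiv.piEquivPiSubtypeProd, Equiv.piEquivPiSubtypeProd, hp]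
  · simp [MeasurableEquiv.piEquivPiSubtypeProd, Equiv.piEquivPiSubtypeProd, hp, flipCols]

variable {Ω : Type*} [MeasurableSpace Ω] {P : Measure Ω} [IsProbabilityMeasure P]
  {A : Ω → Matrix (Fin d) (Fin d) ℝ}

/-- After the flips of columns the entries on and below the diagonal are independent with laws
`entryLaw`, whatever the signs of the diagonal entries of `A` are. -/
lemma IsBartlett.map_flipCols (hA : IsBartlett P ν A) (hν : (d : ℝ) - 1 < ν) :
    P.map (fun ω => flipCols (symCoord (A ω))) = Measure.pi (entryLaw ν) := by
  have hmeas : ∀ p : {p : Fin d × Fin d // p.2 ≤ p.1},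
      AEMeasurable (fun ω => A ω p.1.1 p.1.2) P := fun p => hA.aemeasurable _ _
  have hind : iIndepFun (fun (p : {p : Fin d × Fin d // p.2 ≤ p.1}) ω => A ω p.1.1 p.1.2) P :=
    hA.indep.precomp Subtype.val_injective
  have hmap := (iIndepFun_iff_map_fun_eq_pi_map hmeas).mp hind
  have hprob : ∀ p : {p : Fin d × Fin d // p.2 ≤ p.1},
      IsProbabilityMeasure (P.map fun ω => A ω p.1.1 p.1.2) := fun p =>
    Measure.isProbabilityMeasure_map (hmeas p)
  have hflip := measurePreserving_flipCols hν
    (fun p : {p : Fin d × Fin d // p.2 ≤ p.1} => P.map fun ω => A ω p.1.1 p.1.2)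
    (by
      rintro ⟨⟨i, j⟩, hij⟩ h
      obtain rfl : i = j := h
      rw [entryLaw, if_pos rfl, ← (hA.diag i).map_eq,
        AEMeasurable.map_map_of_aemeasurable continuous_abs.measurable.aemeasurable
          (hA.aemeasurable i i),
        AEMeasurable.map_map_of_aemeasurable Real.continuous_sqrt.measurable.aemeasurable
          (hA.diag i).aemeasurable]
      congr 1
      funext ω
      exact (Real.sqrt_sq_eq_abs _).symm)
    (fun p hp => (hA.offDiag p.1.1 p.1.2 (lt_of_le_of_ne p.2 (Ne.symm hp))).map_eq)
  rw [← hflip.map_eq, ← hmap, AEMeasurable.map_map_of_aemeasurable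
    hflip.measurable.aemeasurable (aemeasurable_pi_lambda _ hmeas)]
  rfl

end Law

/-! ### The Wishart law of the Bartlett matrices -/

section Wishart

variable {d : ℕ} {ν : ℝ}

@[to_additive]
lemma prod_lowerIndex {M : Type*} [CommMonoid M] (F : Fin d → Fin d → M) :
    ∏ p : {p : Fin d × Fin d // p.2 ≤ p.1}, F p.1.1 p.1.2 = ∏ i, ∏ j ∈ Finset.Iic i, F i j := by
  have h := Finset.prod_subtype (p := fun p : Fin d × Fin d => p.2 ≤ p.1) (F := inferInstance)
    (Finset.univ.filter fun p : Fin d × Fin d => p.2 ≤ p.1) (by simp)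
    (fun p : Fin d × Fin d => F p.1 p.2)
  rw [← h, Finset.prod_filter, ← Finset.univ_product_univ, Finset.prod_product]
  refine Finset.prod_congr rfl fun i _ => ?_
  rw [← Finset.prod_filter]
  congr 1
  ext j
  simp

lemma prod_lowerIndex_fst (f : Fin d → ℝ) :
    ∏ p : {p : Fin d × Fin d // p.2 ≤ p.1}, f p.1.1 = ∏ i, f i ^ ((i : ℕ) + 1) := by
  rw [prod_lowerIndex fun i _ => f i]
  exact Finset.prod_congr rfl fun i _ => by rw [Finset.prod_const, Fin.card_Iic]

lemma prod_lowerIndex_snd (f : Fin d → ℝ) :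
    ∏ p : {p : Fin d × Fin d // p.2 ≤ p.1}, f p.1.2 = ∏ i, f i ^ (d - (i : ℕ)) := by
  rw [prod_lowerIndex fun _ j => f j, Finset.prod_comm' (t' := Finset.univ)
    (s' := fun j => Finset.Ici j) (by simp)]
  exact Finset.prod_congr rfl fun i _ => by rw [Finset.prod_const, Fin.card_Ici]

lemma prod_lowerIndex_ite (f g : Fin d → ℝ) :
    ∏ p : {p : Fin d × Fin d // p.2 ≤ p.1}, (if p.1.1 = p.1.2 then f p.1.1 else g p.1.1) =
      ∏ i, (f i * g i ^ (i : ℕ)) := by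
  rw [prod_lowerIndex fun i j => if i = j then f i else g i]
  refine Finset.prod_congr rfl fun i _ => ?_
  rw [← Finset.Iio_insert, Finset.prod_insert (by simp), if_pos rfl,
    Finset.prod_congr rfl fun j hj => if_neg (Finset.mem_Iio.mp hj).ne', Finset.prod_const,
    Fin.card_Iio]

lemma pi_rpow_eq_prod (d : ℕ) :
    Real.pi ^ ((d : ℝ) * ((d : ℝ) - 1) / 4) = ∏ i : Fin d, Real.pi ^ (((i : ℕ) : ℝ) / 2) := by
  rw [← Real.rpow_sum_of_pos Real.pi_pos, Fin.sum_univ_eq_sum_range (fun i => (i : ℝ) / 2)]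
  congr 1
  induction d with
  | zero => simp
  | succ n ih =>
    rw [Finset.sum_range_succ, ← ih]
    push_cast
    ring

lemma multiGamma_eq_prod (d : ℕ) (a : ℝ) :
    multiGamma d a =
      ∏ i : Fin d, (Real.pi ^ (((i : ℕ) : ℝ) / 2) * Real.Gamma (a - ((i : ℕ) : ℝ) / 2)) := by
  rw [multiGamma, pi_rpow_eq_prod, Finset.prod_mul_distrib]

lemma multiGamma_pos (hν : (d : ℝ) - 1 < ν) : 0 < multiGamma d (ν / 2) := by
  refine mul_pos (Real.rpow_pos_of_pos Real.pi_pos _) (Finset.prod_pos fun i _ => ?_)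
  refine Real.Gamma_pos_of_pos ?_
  have := sub_natCast_pos hν i
  linarith

/-- The factors belonging to the `i`-th row in the Wishart density in Cholesky coordinates. -/
lemma row_factor (i : Fin d) (hi : 0 < ν - ((i : ℕ) : ℝ)) {t : ℝ} (ht : 0 < t) :
    2 * t ^ (d - (i : ℕ)) * t ^ (ν - d - 1) /
      (2 ^ (ν / 2) * (Real.pi ^ (((i : ℕ) : ℝ) / 2) * Real.Gamma (ν / 2 - ((i : ℕ) : ℝ) / 2))) =
    2 * ((1 / 2) ^ ((ν - ((i : ℕ) : ℝ)) / 2) / Real.Gamma ((ν - ((i : ℕ) : ℝ)) / 2)) *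
      t ^ (ν - ((i : ℕ) : ℝ) - 1) * (√(2 * Real.pi))⁻¹ ^ (i : ℕ) := by
  have hΓ : ν / 2 - ((i : ℕ) : ℝ) / 2 = (ν - ((i : ℕ) : ℝ)) / 2 := by ring
  have hΓpos := Real.Gamma_pos_of_pos (half_pos hi)
  have ht' : t ^ (d - (i : ℕ)) * t ^ (ν - d - 1) = t ^ (ν - ((i : ℕ) : ℝ) - 1) := by
    rw [← Real.rpow_natCast, ← Real.rpow_add ht, Nat.cast_sub i.2.le]
    congr 1
    ring
  have hsqrt : √(2 * Real.pi) ^ (i : ℕ) =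
      2 ^ (((i : ℕ) : ℝ) / 2) * Real.pi ^ (((i : ℕ) : ℝ) / 2) := by
    rw [Real.sqrt_eq_rpow, ← Real.rpow_natCast, ← Real.rpow_mul (by positivity),
      Real.mul_rpow two_pos.le Real.pi_pos.le]
    congr 2 <;> ring
  have htwo : (2 : ℝ) ^ (ν / 2) =
      2 ^ ((ν - ((i : ℕ) : ℝ)) / 2) * 2 ^ (((i : ℕ) : ℝ) / 2) := by
    rw [← Real.rpow_add two_pos]
    congr 1
    ring
  rw [hΓ, mul_assoc 2, ht', inv_pow, hsqrt, htwo, one_div, Real.inv_rpow two_pos.le]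
  have h1 : (0 : ℝ) < 2 ^ ((ν - ((i : ℕ) : ℝ)) / 2) := by positivity
  have h2 : (0 : ℝ) < 2 ^ (((i : ℕ) : ℝ) / 2) := by positivity
  have h3 : (0 : ℝ) < Real.pi ^ (((i : ℕ) : ℝ) / 2) := by positivity
  field_simp

lemma trace_mul_transpose_lowMat (t : SymCoord d) :
    (lowMat t * (lowMat t)ᵀ).trace = ∑ p, t p ^ 2 := by
  have h := sum_lowerIndex (d := d) fun i j => lowMat t i j ^ 2
  have h' : ∀ p : {p : Fin d × Fin d // p.2 ≤ p.1}, lowMat t p.1.1 p.1.2 = t p := fun p =>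
    lowMat_apply_of_le t p.2
  simp only [h'] at h
  rw [h, Matrix.trace]
  refine Finset.sum_congr rfl fun i _ => ?_
  rw [Matrix.diag_apply, Matrix.mul_apply]
  refine (Finset.sum_subset (Finset.subset_univ _) fun j _ hj => ?_).symm.trans
    (Finset.sum_congr rfl fun j _ => (sq _).symm)
  rw [lowMat_apply_of_lt t (by simpa using hj), zero_mul]

/-- The joint density of the entries, with the diagonal and the off-diagonal constants collected by
rows. -/
lemma prod_entryPDF {t : SymCoord d} (ht : t ∈ posDiag d) :
    ∏ p, entryPDF ν p (t p) =
      (∏ i : Fin d, (2 * ((1 / 2) ^ ((ν - ((i : ℕ) : ℝ)) / 2) /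
        Real.Gamma ((ν - ((i : ℕ) : ℝ)) / 2)) * (lowMat t i i) ^ (ν - ((i : ℕ) : ℝ) - 1) *
          (√(2 * Real.pi))⁻¹ ^ (i : ℕ))) *
        Real.exp (-(lowMat t * (lowMat t)ᵀ).trace / 2) := by
  rw [← prod_lowerIndex_ite, trace_mul_transpose_lowMat, neg_div, Finset.sum_div,
    ← Finset.sum_neg_distrib, Real.exp_sum, ← Finset.prod_mul_distrib]
  refine Finset.prod_congr rfl fun p _ => ?_
  rcases p with ⟨⟨i, j⟩, hij⟩
  rw [entryPDF]
  by_cases h : i = j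
  · subst h
    rw [if_pos rfl, if_pos rfl, chiPDF, if_pos (ht i), lowMat_apply_of_le t le_rfl]
  · rw [if_neg h, if_neg h, gaussianPDFReal]
    simp [neg_div]

lemma prod_entryPDF_eq_zero {t : SymCoord d} (ht : t ∉ posDiag d) :
    ∏ p, entryPDF ν p (t p) = 0 := by
  simp only [posDiag, Set.mem_ofPred_eq, not_forall] at ht
  obtain ⟨i, hi⟩ := ht
  refine Finset.prod_eq_zero (Finset.mem_univ ⟨(i, i), le_rfl⟩) ?_
  rw [entryPDF, if_pos rfl, chiPDF, if_neg hi]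

/-- The parametrization `T ↦ (L T) (L T)ᵀ` of positive definite matrices by Cholesky factors. -/
def bartlettMap (L : Matrix (Fin d) (Fin d) ℝ) (t : SymCoord d) : SymCoord d :=
  gram (mulLow L t)

lemma bartlettMap_eq {L : Matrix (Fin d) (Fin d) ℝ} (hL : L ∈ choleskyFactors d)
    (t : SymCoord d) :
    bartlettMap L t = symCoord (L * (lowMat t * (lowMat t)ᵀ) * Lᵀ) := by
  rw [bartlettMap, gram, lowMat_mulLow hL.1, Matrix.transpose_mul]
  simp only [Matrix.mul_assoc]

lemma symMat_bartlettMap {L : Matrix (Fin d) (Fin d) ℝ} (hL : L ∈ choleskyFactors d)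
    (t : SymCoord d) :
    symMat (bartlettMap L t) = (L * lowMat t) * (L * lowMat t)ᵀ := by
  rw [bartlettMap, gram, lowMat_mulLow hL.1]
  exact symMat_symCoord (Matrix.isSymm_mul_transpose_self _)

lemma injOn_bartlettMap {L : Matrix (Fin d) (Fin d) ℝ} (hL : L ∈ choleskyFactors d) :
    Set.InjOn (bartlettMap L) (posDiag d) := by
  intro s hs t ht hst
  have h := congrArg symMat hst
  rw [symMat_bartlettMap hL, symMat_bartlettMap hL] at h
  have h' := choleskyFactors_ext (mul_mem_choleskyFactors hL (lowMat_mem_choleskyFactors hs))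
    (mul_mem_choleskyFactors hL (lowMat_mem_choleskyFactors ht)) fun i j _ => by rw [h]
  have hu : IsUnit L := by
    rw [Matrix.isUnit_iff_isUnit_det]
    exact (det_pos_of_mem_choleskyFactors hL).ne'.isUnit
  rw [← symCoord_lowMat s, ← symCoord_lowMat t, hu.mul_left_cancel h']

lemma inv_mem_choleskyFactors {L : Matrix (Fin d) (Fin d) ℝ} (hL : L ∈ choleskyFactors d) :
    L⁻¹ ∈ choleskyFactors d := by
  have hu : IsUnit L.det := (det_pos_of_mem_choleskyFactors hL).ne'.isUnit
  have _ : Invertible L := Matrix.invertibleOfIsUnitDet L hu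
  have hlow : ∀ i j, i < j → L⁻¹ i j = 0 := fun i j hij =>
    Matrix.blockTriangular_inv_of_blockTriangular (b := OrderDual.toDual)
      (fun i j hij => hL.1 i j hij) hij
  refine ⟨hlow, fun i => ?_⟩
  have h1 : (L * L⁻¹) i i = 1 := by rw [Matrix.mul_nonsing_inv L hu, Matrix.one_apply_eq]
  rw [Matrix.mul_apply, Finset.sum_eq_single i] at h1
  · exact pos_of_mul_pos_right (h1 ▸ one_pos) (hL.2 i).le
  · intro k _ hk
    rcases lt_or_gt_of_ne hk with h | h
    · rw [hlow k i h, mul_zero]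
    · rw [hL.1 i k h, zero_mul]
  · simp

lemma image_bartlettMap {L : Matrix (Fin d) (Fin d) ℝ} (hL : L ∈ choleskyFactors d) :
    bartlettMap L '' posDiag d = {v | (symMat v).PosDef} := by
  have hu : IsUnit L.det := (det_pos_of_mem_choleskyFactors hL).ne'.isUnit
  ext v
  constructor
  · rintro ⟨t, ht, rfl⟩
    rw [Set.mem_ofPred_eq, symMat_bartlettMap hL]
    exact posDef_mul_transpose (mul_mem_choleskyFactors hL (lowMat_mem_choleskyFactors ht))
  · intro hv
    obtain ⟨U, hU, h⟩ := exists_cholesky hv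
    have hT := mul_mem_choleskyFactors (inv_mem_choleskyFactors hL) hU
    refine ⟨symCoord (L⁻¹ * U), symCoord_mem_posDiag hT, ?_⟩
    rw [← symCoord_symMat (bartlettMap L _), symMat_bartlettMap hL, lowMat_symCoord hT.1,
      ← Matrix.mul_assoc, Matrix.mul_nonsing_inv L hu, Matrix.one_mul, ← h, symCoord_symMat]

/-- The derivative of `bartlettMap`. -/
noncomputable def bartlettDeriv (L : Matrix (Fin d) (Fin d) ℝ) (t : SymCoord d) :
    SymCoord d →L[ℝ] SymCoord d :=
  (LinearMap.toContinuousLinearMap (gramDeriv (mulLow L t))).comp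
    (LinearMap.toContinuousLinearMap (mulLow L))

lemma hasFDerivAt_bartlettMap (L : Matrix (Fin d) (Fin d) ℝ) (t : SymCoord d) :
    HasFDerivAt (bartlettMap L) (bartlettDeriv L t) t :=
  (hasFDerivAt_gram (mulLow L t)).comp t
    (LinearMap.toContinuousLinearMap (mulLow L)).hasFDerivAt

lemma det_bartlettDeriv {L : Matrix (Fin d) (Fin d) ℝ} (hL : L ∈ choleskyFactors d)
    (t : SymCoord d) :
    (bartlettDeriv L t).det =
      ∏ i : Fin d, (2 * L i i ^ (d + 1) * lowMat t i i ^ (d - (i : ℕ))) := by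
  have h1 : (bartlettDeriv L t).det =
      LinearMap.det (gramDeriv (mulLow L t)) * LinearMap.det (mulLow L) := by
    rw [← LinearMap.det_comp]
    rfl
  have h2 : ∀ j : Fin d, mulLow L t ⟨(j, j), le_rfl⟩ = L j j * lowMat t j j := by
    intro j
    rw [← lowMat_apply_of_le (mulLow L t) le_rfl, lowMat_mulLow hL.1, Matrix.mul_apply,
      Finset.sum_eq_single j]
    · intro k _ hk
      rcases lt_or_gt_of_ne hk with h | h
      · rw [lowMat_apply_of_lt t h, mul_zero]
      · rw [hL.1 j k h, zero_mul]
    · simp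
  rw [h1, det_gramDeriv, det_mulLow hL.1, Finset.prod_mul_distrib]
  simp only [h2]
  rw [prod_lowerIndex_ite (fun _ => 2) (fun _ => 1), prod_lowerIndex_fst (fun i => L i i),
    prod_lowerIndex_snd (fun j => L j j * lowMat t j j), ← Finset.prod_mul_distrib,
    ← Finset.prod_mul_distrib]
  refine Finset.prod_congr rfl fun i _ => ?_
  have : d + 1 = (d - (i : ℕ)) + ((i : ℕ) + 1) := by omega
  rw [this, pow_add, mul_pow, one_pow]
  ring

/-- In Cholesky coordinates the Wishart density is the joint density of the Bartlett variables. -/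
lemma abs_det_bartlettDeriv_mul_wishartPDF (hν : (d : ℝ) - 1 < ν)
    {L : Matrix (Fin d) (Fin d) ℝ} (hL : L ∈ choleskyFactors d) {t : SymCoord d}
    (ht : t ∈ posDiag d) :
    |(bartlettDeriv L t).det| * wishartPDF (L * Lᵀ) ν (symMat (bartlettMap L t)) =
      ∏ p, entryPDF ν p (t p) := by
  have hT := lowMat_mem_choleskyFactors ht
  have hLT := mul_mem_choleskyFactors hL hT
  have hLdet := det_pos_of_mem_choleskyFactors hL
  have hTdet := det_pos_of_mem_choleskyFactors hT
  have hu : IsUnit L.det := hLdet.ne'.isUnit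
  have htrace : ((L * Lᵀ)⁻¹ * ((L * lowMat t) * (L * lowMat t)ᵀ)).trace =
      (lowMat t * (lowMat t)ᵀ).trace := by
    have : (L * Lᵀ)⁻¹ * ((L * lowMat t) * (L * lowMat t)ᵀ) =
        (Lᵀ)⁻¹ * ((lowMat t * (lowMat t)ᵀ) * Lᵀ) := by
      rw [Matrix.mul_inv_rev, Matrix.transpose_mul]
      simp only [Matrix.mul_assoc]
      rw [← Matrix.mul_assoc L⁻¹ L, Matrix.nonsing_inv_mul L hu, Matrix.one_mul]
    rw [this, Matrix.trace_mul_comm, Matrix.mul_assoc,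
      Matrix.mul_nonsing_inv _ (by rwa [Matrix.det_transpose]), Matrix.mul_one]
  have hdetpos : 0 < (bartlettDeriv L t).det := by
    rw [det_bartlettDeriv hL]
    exact Finset.prod_pos fun i _ => by
      have := hL.2 i; have := hT.2 i; positivity
  have hS : (L * Lᵀ).det ^ (ν / 2) = L.det ^ ν := by
    rw [Matrix.det_mul, Matrix.det_transpose, ← sq, ← Real.rpow_natCast, ← Real.rpow_mul hLdet.le]
    congr 1
    push_cast
    ring
  have hX : ((L * lowMat t) * (L * lowMat t)ᵀ).det ^ ((ν - d - 1) / 2) =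
      L.det ^ (ν - d - 1) * (lowMat t).det ^ (ν - d - 1) := by
    rw [Matrix.det_mul, Matrix.det_transpose, Matrix.det_mul, ← sq, ← Real.rpow_natCast,
      ← Real.rpow_mul (by positivity), Real.mul_rpow hLdet.le hTdet.le]
    congr 2 <;> (push_cast; ring)
  have hL' : L.det ^ (d + 1) * L.det ^ (ν - d - 1) = L.det ^ ν := by
    rw [← Real.rpow_natCast, ← Real.rpow_add hLdet]
    congr 1
    push_cast
    ring
  have h2 : (2 : ℝ) ^ (ν * d / 2) = ∏ _i : Fin d, (2 : ℝ) ^ (ν / 2) := by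
    rw [Finset.prod_const, Finset.card_univ, Fintype.card_fin, ← Real.rpow_natCast,
      ← Real.rpow_mul two_pos.le]
    congr 1
    ring
  have hdet : (bartlettDeriv L t).det =
      L.det ^ (d + 1) * ∏ i : Fin d, (2 * lowMat t i i ^ (d - (i : ℕ))) := by
    rw [det_bartlettDeriv hL, det_of_lower hL.1, ← Finset.prod_pow, ← Finset.prod_mul_distrib]
    exact Finset.prod_congr rfl fun i _ => by ring
  have hTpow : (lowMat t).det ^ (ν - d - 1) = ∏ i, lowMat t i i ^ (ν - d - 1) := by
    rw [det_of_lower hT.1, Real.finsetProd_rpow _ _ fun i _ => (hT.2 i).le]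
  rw [abs_of_pos hdetpos, symMat_bartlettMap hL, wishartPDF, if_pos (posDef_mul_transpose hLT),
    htrace, prod_entryPDF ht, hS, hX]
  rw [Finset.prod_congr rfl fun i _ =>
    (row_factor i (sub_natCast_pos hν i) (hT.2 i)).symm, Finset.prod_div_distrib,
    Finset.prod_mul_distrib, Finset.prod_mul_distrib (f := fun _ => (2 : ℝ) ^ (ν / 2)),
    ← multiGamma_eq_prod, ← h2, ← hTpow, hdet, ← hL']
  have h3 := multiGamma_pos hν
  have h4 : (0 : ℝ) < 2 ^ (ν * d / 2) := by positivity
  have h5 : 0 < L.det ^ (ν - d - 1) := by positivity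
  field_simp

/-- The Wishart distribution, as a measure on the coordinates of symmetric matrices. -/
noncomputable def wishartMeasure (S : Matrix (Fin d) (Fin d) ℝ) (ν : ℝ) : Measure (SymCoord d) :=
  volume.withDensity fun v => ENNReal.ofReal (wishartPDF S ν (symMat v))

lemma continuous_bartlettMap (L : Matrix (Fin d) (Fin d) ℝ) : Continuous (bartlettMap L) :=
  continuous_iff_continuousAt.mpr fun t => (hasFDerivAt_bartlettMap L t).continuousAt

/-- The change of variables formula for `bartlettMap`, as an identity of measures. -/
lemma map_bartlettMap_pi_entryLaw (hν : (d : ℝ) - 1 < ν) {L : Matrix (Fin d) (Fin d) ℝ}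
    (hL : L ∈ choleskyFactors d) :
    (Measure.pi (entryLaw ν)).map (bartlettMap L) = wishartMeasure (L * Lᵀ) ν := by
  classical
  have hmeas := (continuous_bartlettMap L).measurable
  have hpos : MeasurableSet (posDiag d) := (isOpen_posDiag d).measurableSet
  have himg : MeasurableSet (bartlettMap L '' posDiag d) :=
    measurable_image_of_fderivWithin hpos
      (fun t _ => (hasFDerivAt_bartlettMap L t).hasFDerivWithinAt) (injOn_bartlettMap hL)
  ext s hs
  rw [Measure.map_apply hmeas hs, pi_entryLaw_eq hν, wishartMeasure,
    withDensity_apply _ (hmeas hs), withDensity_apply _ hs, ← lintegral_indicator (hmeas hs),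
    ← lintegral_indicator hs]
  have h1 : ∫⁻ t : SymCoord d, (bartlettMap L ⁻¹' s).indicator
        (fun t => ENNReal.ofReal (∏ p, entryPDF ν p (t p))) t =
      ∫⁻ t in posDiag d, (bartlettMap L ⁻¹' s).indicator
        (fun t => ENNReal.ofReal (∏ p, entryPDF ν p (t p))) t := by
    rw [← lintegral_indicator hpos]
    congr 1 with t
    by_cases ht : t ∈ posDiag d
    · rw [Set.indicator_of_mem ht]
    · rw [Set.indicator_of_notMem ht, Set.indicator_apply, prod_entryPDF_eq_zero ht,
        ENNReal.ofReal_zero, ite_self]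
  have h2 : ∫⁻ v : SymCoord d, s.indicator
        (fun v => ENNReal.ofReal (wishartPDF (L * Lᵀ) ν (symMat v))) v =
      ∫⁻ v in bartlettMap L '' posDiag d, s.indicator
        (fun v => ENNReal.ofReal (wishartPDF (L * Lᵀ) ν (symMat v))) v := by
    rw [← lintegral_indicator himg]
    congr 1 with v
    by_cases hv : v ∈ bartlettMap L '' posDiag d
    · rw [Set.indicator_of_mem hv]
    · rw [Set.indicator_of_notMem hv, Set.indicator_apply]
      rw [image_bartlettMap hL, Set.mem_ofPred_eq] at hv
      rw [wishartPDF, if_neg hv, ENNReal.ofReal_zero, ite_self]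
  rw [h1, h2, lintegral_image_eq_lintegral_abs_det_fderiv_mul volume hpos
    (fun t _ => (hasFDerivAt_bartlettMap L t).hasFDerivWithinAt) (injOn_bartlettMap hL)]
  refine setLIntegral_congr_fun hpos fun t ht => ?_
  simp only [Set.indicator_apply, Set.mem_preimage]
  split_ifs
  · rw [← ENNReal.ofReal_mul (abs_nonneg _), abs_det_bartlettDeriv_mul_wishartPDF hν hL ht]
  · simp

lemma measurableSet_posDef : MeasurableSet {v : SymCoord d | (symMat v).PosDef} := by
  have hL := one_mem_choleskyFactors d
  rw [← image_bartlettMap hL]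
  exact measurable_image_of_fderivWithin (isOpen_posDiag d).measurableSet
      (fun t _ => (hasFDerivAt_bartlettMap _ t).hasFDerivWithinAt) (injOn_bartlettMap hL)

variable {Ω : Type*} [MeasurableSpace Ω] {P : Measure Ω} {A : Ω → Matrix (Fin d) (Fin d) ℝ}

lemma IsBartlett.aemeasurable_symCoord (hA : IsBartlett P ν A) (L : Matrix (Fin d) (Fin d) ℝ) :
    AEMeasurable (fun ω => symCoord (L * A ω * (A ω)ᵀ * Lᵀ)) P := by
  refine aemeasurable_pi_lambda _ fun p => ?_
  simp only [symCoord, Matrix.mul_apply, Matrix.transpose_apply, Finset.sum_mul]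
  have := hA.aemeasurable
  fun_prop

/-- **Bartlett decomposition**: if `A` is a Bartlett variable, then `L A Aᵀ Lᵀ` has the Wishart
distribution with scale matrix `L Lᵀ`. -/
lemma IsBartlett.map_eq_wishartMeasure [IsProbabilityMeasure P] (hA : IsBartlett P ν A)
    (hν : (d : ℝ) - 1 < ν) {L : Matrix (Fin d) (Fin d) ℝ} (hL : L ∈ choleskyFactors d) :
    P.map (fun ω => symCoord (L * A ω * (A ω)ᵀ * Lᵀ)) = wishartMeasure (L * Lᵀ) ν := by
  have hmeas : AEMeasurable (fun ω => flipCols (symCoord (A ω))) P := by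
    refine aemeasurable_pi_lambda _ fun p => ?_
    exact (hA.aemeasurable _ _).mul (measurable_sgn.comp_aemeasurable (hA.aemeasurable _ _))
  rw [← map_bartlettMap_pi_entryLaw hν hL, ← hA.map_flipCols hν,
    AEMeasurable.map_map_of_aemeasurable (continuous_bartlettMap L).measurable.aemeasurable hmeas]
  congr 1
  funext ω
  rw [Function.comp_apply, bartlettMap_eq hL, lowMat_flipCols_mul_transpose,
    lowMat_symCoord (hA.lower ω)]
  simp only [Matrix.mul_assoc]

end Wishart

/-! ### Second moments of the Bartlett variables -/

section Moments

/-- The mean of a gamma distribution: `x` times the density with shape `a` is `a / s` times the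
density with shape `a + 1`. -/
lemma lintegral_id_gammaMeasure {a s : ℝ} (ha : 0 < a) (hs : 0 < s) :
    ∫⁻ x, ENNReal.ofReal x ∂(gammaMeasure a s) = ENNReal.ofReal (a / s) := by
  have hΓ := Real.Gamma_pos_of_pos ha
  have hpdf : Measurable (gammaPDF a s) := (measurable_gammaPDFReal a s).ennreal_ofReal
  rw [gammaMeasure, lintegral_withDensity_eq_lintegral_mul _ hpdf ENNReal.measurable_ofReal]
  have h : ∀ x, (gammaPDF a s * fun x => ENNReal.ofReal x) x =
      ENNReal.ofReal (a / s) * gammaPDF (a + 1) s x := by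
    intro x
    rw [Pi.mul_apply]
    rcases le_or_gt x 0 with hx | hx
    · rw [ENNReal.ofReal_of_nonpos hx, mul_zero]
      rcases hx.lt_or_eq with hx | rfl
      · rw [gammaPDF_of_neg hx, mul_zero]
      · rw [gammaPDF_of_nonneg le_rfl, add_sub_cancel_right, Real.zero_rpow ha.ne']
        simp
    · rw [gammaPDF_of_nonneg hx.le, gammaPDF_of_nonneg hx.le, ← ENNReal.ofReal_mul (by positivity),
        ← ENNReal.ofReal_mul (by positivity)]
      congr 1
      have hpow : x ^ (a - 1) * x = x ^ a := by
        nth_rw 2 [← Real.rpow_one x]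
        rw [← Real.rpow_add hx, sub_add_cancel]
      rw [Real.Gamma_add_one ha.ne', Real.rpow_add_one hs.ne', add_sub_cancel_right, ← hpow]
      field_simp
  simp_rw [h]
  have hpdf' : Measurable (gammaPDF (a + 1) s) := (measurable_gammaPDFReal _ s).ennreal_ofReal
  rw [lintegral_const_mul _ hpdf',
    lintegral_gammaPDF_eq_one (by linarith) hs, mul_one]

lemma ae_nonneg_gammaMeasure (a s : ℝ) : 0 ≤ᵐ[gammaMeasure a s] fun x : ℝ => x := by
  have hpdf : Measurable (gammaPDF a s) := (measurable_gammaPDFReal a s).ennreal_ofReal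
  rw [gammaMeasure, Filter.EventuallyLE, ae_withDensity_iff hpdf]
  refine ae_of_all _ fun x hx => ?_
  by_contra h
  exact hx (gammaPDF_of_neg (not_le.mp h))

lemma integrable_id_chiSquared {k : ℝ} (hk : 0 < k) :
    Integrable (fun x : ℝ => x) (chiSquared k) := by
  refine ⟨measurable_id.aestronglyMeasurable, ?_⟩
  rw [chiSquared, hasFiniteIntegral_iff_ofReal (ae_nonneg_gammaMeasure _ _),
    lintegral_id_gammaMeasure (half_pos hk) (by norm_num)]
  exact ENNReal.ofReal_lt_top

lemma integral_id_chiSquared {k : ℝ} (hk : 0 < k) : ∫ x, x ∂(chiSquared k) = k := by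
  rw [chiSquared, integral_eq_lintegral_of_nonneg_ae (ae_nonneg_gammaMeasure _ _)
    measurable_id.aestronglyMeasurable, lintegral_id_gammaMeasure (half_pos hk) (by norm_num),
    ENNReal.toReal_ofReal (by positivity)]
  ring

variable {d : ℕ} {ν : ℝ} {Ω : Type*} [MeasurableSpace Ω] {P : Measure Ω}
  {A : Ω → Matrix (Fin d) (Fin d) ℝ}

lemma IsBartlett.memLp_two (hA : IsBartlett P ν A) (hν : (d : ℝ) - 1 < ν) (i j : Fin d) :
    MemLp (fun ω => A ω i j) 2 P := by
  rcases lt_trichotomy i j with h | rfl | h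
  · simp only [hA.lower _ i j h]
    exact MemLp.zero
  · rw [memLp_two_iff_integrable_sq (hA.aemeasurable i i).aestronglyMeasurable]
    have := integrable_id_chiSquared (sub_natCast_pos hν i)
    rw [← (hA.diag i).map_eq] at this
    exact this.comp_aemeasurable (hA.diag i).aemeasurable
  · have := memLp_id_gaussianReal (μ := 0) (v := 1) 2
    rw [← (hA.offDiag i j h).map_eq] at this
    exact this.comp_of_map (hA.aemeasurable i j)

lemma IsBartlett.integral_sq_diag (hA : IsBartlett P ν A) (hν : (d : ℝ) - 1 < ν) (i : Fin d) :
    ∫ ω, A ω i i * A ω i i ∂P = ν - ((i : ℕ) : ℝ) := by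
  rw [← integral_id_chiSquared (sub_natCast_pos hν i), ← (hA.diag i).map_eq,
    integral_map (hA.diag i).aemeasurable measurable_id'.aestronglyMeasurable]
  simp only [sq]

lemma IsBartlett.integral_offDiag (hA : IsBartlett P ν A) {i j : Fin d} (h : j < i) :
    ∫ ω, A ω i j ∂P = 0 := by
  have h1 := integral_id_gaussianReal (μ := 0) (v := 1)
  rw [← (hA.offDiag i j h).map_eq, integral_map (hA.aemeasurable i j)
    measurable_id'.aestronglyMeasurable] at h1
  exact h1

lemma IsBartlett.integral_sq_offDiag (hA : IsBartlett P ν A) {i j : Fin d} (h : j < i) :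
    ∫ ω, A ω i j * A ω i j ∂P = 1 := by
  have h1 : ∫ x, x ^ 2 ∂(gaussianReal 0 1) = 1 := by
    have h2 := variance_fun_id_gaussianReal (μ := 0) (v := 1)
    rw [variance_of_integral_eq_zero measurable_id'.aemeasurable integral_id_gaussianReal] at h2
    simpa using h2
  rw [← (hA.offDiag i j h).map_eq, integral_map (hA.aemeasurable i j)
    (measurable_id'.pow_const 2).aestronglyMeasurable] at h1
  simpa only [sq] using h1

lemma IsBartlett.integral_mul_of_ne (hA : IsBartlett P ν A) {i k : Fin d} (hik : i ≠ k)
    (j : Fin d) : ∫ ω, A ω i j * A ω k j ∂P = 0 := by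
  rcases lt_or_ge i j with h | hi
  · simp [hA.lower _ i j h]
  rcases lt_or_ge k j with h | hk
  · simp [hA.lower _ k j h]
  have hind : IndepFun (fun ω => A ω i j) (fun ω => A ω k j) P :=
    hA.indep.indepFun (i := (i, j)) (j := (k, j)) (by simp [hik])
  rw [hind.integral_fun_mul_eq_mul_integral (hA.aemeasurable i j).aestronglyMeasurable
    (hA.aemeasurable k j).aestronglyMeasurable]
  rcases hi.lt_or_eq with h | rfl
  · rw [hA.integral_offDiag h, zero_mul]
  · rw [hA.integral_offDiag (lt_of_le_of_ne hk hik), mul_zero]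

lemma IsBartlett.integrable_mul (hA : IsBartlett P ν A) (hν : (d : ℝ) - 1 < ν) (i j k l : Fin d) :
    Integrable (fun ω => A ω i j * A ω k l) P :=
  (hA.memLp_two hν i j).integrable_mul (hA.memLp_two hν k l)

lemma IsBartlett.integrable_mul_transpose (hA : IsBartlett P ν A) (hν : (d : ℝ) - 1 < ν)
    (i k : Fin d) : Integrable (fun ω => (A ω * (A ω)ᵀ) i k) P := by
  simp only [Matrix.mul_apply, Matrix.transpose_apply]
  exact integrable_finsetSum _ fun j _ => hA.integrable_mul hν i j k j

lemma IsBartlett.integral_mul_transpose (hA : IsBartlett P ν A) (hν : (d : ℝ) - 1 < ν)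
    (i k : Fin d) :
    ∫ ω, (A ω * (A ω)ᵀ) i k ∂P = (ν • (1 : Matrix (Fin d) (Fin d) ℝ)) i k := by
  simp only [Matrix.mul_apply, Matrix.transpose_apply]
  rw [integral_finsetSum _ fun j _ => hA.integrable_mul hν i j k j]
  rcases eq_or_ne i k with rfl | h
  · rw [← Finset.sum_subset (Finset.subset_univ (Finset.Iic i)), ← Finset.Iio_insert,
      Finset.sum_insert (by simp), hA.integral_sq_diag hν,
      Finset.sum_congr rfl fun j hj => hA.integral_sq_offDiag (Finset.mem_Iio.mp hj)]
    · simp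
    · intro j _ hj
      simp [hA.lower _ i j (by simpa using hj)]
  · rw [Finset.sum_eq_zero fun j _ => hA.integral_mul_of_ne h j]
    simp [h]

/-- The mean of `L A Aᵀ Lᵀ` is `ν L Lᵀ`, read through an arbitrary linear functional. -/
lemma IsBartlett.integral_linear (hA : IsBartlett P ν A) (hν : (d : ℝ) - 1 < ν)
    (φ : Matrix (Fin d) (Fin d) ℝ →ₗ[ℝ] ℝ) (L : Matrix (Fin d) (Fin d) ℝ) :
    Integrable (fun ω => φ (L * A ω * (A ω)ᵀ * Lᵀ)) P ∧
      ∫ ω, φ (L * A ω * (A ω)ᵀ * Lᵀ) ∂P = ν * φ (L * Lᵀ) := by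
  let ψ : Matrix (Fin d) (Fin d) ℝ →ₗ[ℝ] ℝ :=
    { toFun := fun X => φ (L * X * Lᵀ)
      map_add' := fun X Y => by rw [Matrix.mul_add, Matrix.add_mul, map_add]
      map_smul' := fun c X => by
        rw [Matrix.mul_smul, Matrix.smul_mul, map_smul, RingHom.id_apply] }
  have hψ : ∀ X, ψ X = ∑ i, ∑ j, X i j * ψ (Matrix.single i j 1) := by
    intro X
    conv_lhs => rw [Matrix.matrix_eq_sum_single X]
    simp only [map_sum]
    refine Finset.sum_congr rfl fun i _ => Finset.sum_congr rfl fun j _ => ?_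
    rw [← smul_eq_mul, ← map_smul, Matrix.smul_single, smul_eq_mul, mul_one]
  have hterm : ∀ ω, φ (L * A ω * (A ω)ᵀ * Lᵀ) =
      ∑ i, ∑ j, (A ω * (A ω)ᵀ) i j * ψ (Matrix.single i j 1) := by
    intro ω
    rw [← hψ, Matrix.mul_assoc L]
    rfl
  have hint : ∀ i j, Integrable
      (fun ω => (A ω * (A ω)ᵀ) i j * ψ (Matrix.single i j 1)) P := fun i j =>
    (hA.integrable_mul_transpose hν i j).mul_const _
  simp_rw [hterm]
  refine ⟨integrable_finsetSum _ fun i _ => integrable_finsetSum _ fun j _ => hint i j, ?_⟩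
  rw [integral_finsetSum _ fun i _ => integrable_finsetSum _ fun j _ => hint i j]
  simp_rw [integral_finsetSum _ fun j _ => hint _ j, integral_mul_const,
    hA.integral_mul_transpose hν]
  rw [← hψ, map_smul, smul_eq_mul]
  change ν * φ (L * 1 * Lᵀ) = _
  rw [Matrix.mul_one]

end Moments

/-! ### Sums of exponentials -/

section LogSumExp

variable {ι : Type*} [Fintype ι]

lemma le_log_sum_exp (q : ι → ℝ) (i : ι) : q i ≤ Real.log (∑ j, Real.exp (q j)) := by
  have h : Real.exp (q i) ≤ ∑ j, Real.exp (q j) :=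
    Finset.single_le_sum (f := fun j => Real.exp (q j)) (fun j _ => (Real.exp_pos _).le)
      (Finset.mem_univ i)
  rw [Real.le_log_iff_exp_le ((Real.exp_pos _).trans_le h)]
  exact h

lemma sum_mul_le_log_sum_exp {p : ι → ℝ} (hp : ∀ i, 0 ≤ p i) (hp1 : ∑ i, p i = 1) (q : ι → ℝ) :
    ∑ i, p i * q i ≤ Real.log (∑ j, Real.exp (q j)) := by
  calc ∑ i, p i * q i ≤ ∑ i, p i * Real.log (∑ j, Real.exp (q j)) :=
        Finset.sum_le_sum fun i _ => mul_le_mul_of_nonneg_left (le_log_sum_exp q i) (hp i)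
    _ = _ := by rw [← Finset.sum_mul, hp1, one_mul]

lemma abs_log_sum_exp_le (q : ι → ℝ) :
    |Real.log (∑ j, Real.exp (q j))| ≤ Real.log (Fintype.card ι) + ∑ j, |q j| := by
  rcases isEmpty_or_nonempty ι with h | ⟨⟨i⟩⟩
  · simp
  have hq : ∀ j, |q j| ≤ ∑ j, |q j| := fun j =>
    Finset.single_le_sum (f := fun j => |q j|) (fun j _ => abs_nonneg _) (Finset.mem_univ j)
  have hcard : (1 : ℝ) ≤ Fintype.card ι := by
    exact_mod_cast Fintype.card_pos_iff.mpr ⟨i⟩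
  rw [abs_le]
  constructor
  · have h1 := le_log_sum_exp q i
    have h2 := neg_abs_le (q i)
    have h3 := hq i
    have h4 := Real.log_nonneg hcard
    linarith
  · have h1 : ∑ j, Real.exp (q j) ≤ Fintype.card ι * Real.exp (∑ j, |q j|) := by
      rw [← nsmul_eq_mul, ← Finset.card_univ]
      exact Finset.sum_le_card_nsmul _ _ _ fun j _ =>
        Real.exp_le_exp.mpr ((le_abs_self _).trans (hq j))
    have h0 : 0 < ∑ j, Real.exp (q j) :=
      Finset.sum_pos (fun j _ => Real.exp_pos _) ⟨i, Finset.mem_univ i⟩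
    calc _ ≤ Real.log (Fintype.card ι * Real.exp (∑ j, |q j|)) := Real.log_le_log h0 h1
      _ = _ := by rw [Real.log_mul (by linarith) (Real.exp_pos _).ne', Real.log_exp]

lemma continuous_log_sum_exp {X : Type*} [TopologicalSpace X] {q : ι → X → ℝ}
    (hq : ∀ i, Continuous (q i)) :
    Continuous fun x => Real.log (∑ j, Real.exp (q j x)) := by
  rcases isEmpty_or_nonempty ι with h | ⟨⟨i⟩⟩
  · simp only [Finset.univ_eq_empty, Finset.sum_empty, Real.log_zero]
    exact continuous_const
  · refine Continuous.log ?_ fun x => ?_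
    · exact continuous_finsetSum _ fun j _ => Real.continuous_exp.comp (hq j)
    · exact (Finset.sum_pos (fun j _ => Real.exp_pos _) ⟨i, Finset.mem_univ i⟩).ne'

end LogSumExp

/-! ### The objective -/

section Objective

variable {N C dX dY : ℕ}

/-- The quadratic form `X ↦ vᵀ X v`, as a linear functional of the matrix `X`. -/
def quad {d : ℕ} (v : Fin d → ℝ) : Matrix (Fin d) (Fin d) ℝ →ₗ[ℝ] ℝ where
  toFun X := v ⬝ᵥ (X *ᵥ v)
  map_add' X Y := by rw [Matrix.add_mulVec, dotProduct_add]
  map_smul' c X := by rw [Matrix.smul_mulVec, dotProduct_smul, RingHom.id_apply]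

lemma trace_transpose_mul_vecMulVec_mul {d : ℕ} (v : Fin d → ℝ) (L : Matrix (Fin d) (Fin d) ℝ) :
    (Lᵀ * Matrix.vecMulVec v v * L).trace = quad v (L * Lᵀ) := by
  rw [Matrix.trace_mul_comm, ← Matrix.mul_assoc, Matrix.mul_vecMulVec, Matrix.trace_vecMulVec,
    dotProduct_comm]
  rfl

/-- `log ∑_{n' ≠ n} exp (-½ (x^n - x^{n'})ᵀ X (x^n - x^{n'}))` as a function of the matrix `X`. -/
noncomputable def logSumQuad (M : Model N dX dY) (n : Fin N) (X : Matrix (Fin dX) (Fin dX) ℝ) : ℝ :=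
  Real.log (∑ n' : {n' : Fin N // n' ≠ n}, Real.exp (-(1 / 2) * quad (M.x n - M.x n') X))

lemma logSumSim_eq (M : Model N dX dY) (n : Fin N) (L A : Matrix (Fin dX) (Fin dX) ℝ) :
    logSumSim M n L A = logSumQuad M n (L * A * Aᵀ * Lᵀ) := rfl

lemma continuous_quad {d : ℕ} (v : Fin d → ℝ) : Continuous (quad v) := by
  change Continuous fun X : Matrix (Fin d) (Fin d) ℝ => v ⬝ᵥ (X *ᵥ v)
  exact continuous_const.dotProduct (continuous_id.matrix_mulVec continuous_const)

lemma continuous_logSumQuad (M : Model N dX dY) (n : Fin N) : Continuous (logSumQuad M n) :=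
  continuous_log_sum_exp fun _ => continuous_const.mul (continuous_quad _)

lemma abs_logSumQuad_le (M : Model N dX dY) (n : Fin N) (X : Matrix (Fin dX) (Fin dX) ℝ) :
    |logSumQuad M n X| ≤ Real.log (Fintype.card {n' : Fin N // n' ≠ n}) +
      ∑ n' : {n' : Fin N // n' ≠ n}, |-(1 / 2) * quad (M.x n - M.x n') X| :=
  abs_log_sum_exp_le _

lemma sum_bigOmega_mul (r : Latent N C → ℝ) (n : Fin N) (f : {n' : Fin N // n' ≠ n} → ℝ) :
    ∑ n', bigOmega r n n' * f n' = ∑ w, r w * f (w n).1 := by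
  simp only [bigOmega, omega, Finset.sum_mul]
  have h1 : ∀ n', ∑ c : Fin C, ∑ w : Latent N C, (if w n = (n', c) then r w else 0) * f n' =
      ∑ w : Latent N C, ∑ c : Fin C, (if w n = (n', c) then r w else 0) * f n' := fun n' =>
    Finset.sum_comm
  simp_rw [h1]
  rw [Finset.sum_comm]
  refine Finset.sum_congr rfl fun w _ => ?_
  rw [← Finset.sum_product', Finset.sum_eq_single (w n)]
  · rw [if_pos rfl]
  · intro a _ ha
    rw [if_neg (by simpa using Ne.symm ha), zero_mul]
  · intro h
    exact absurd (Finset.mem_product.mpr ⟨Finset.mem_univ _, Finset.mem_univ _⟩) h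

lemma bigOmega_nonneg {r : Latent N C → ℝ} (hr : IsLatentPMF r) (n : Fin N)
    (n' : {n' : Fin N // n' ≠ n}) : 0 ≤ bigOmega r n n' :=
  Finset.sum_nonneg fun _ _ => Finset.sum_nonneg fun w _ => by
    split_ifs
    · exact hr.nonneg w
    · exact le_rfl

lemma sum_bigOmega {r : Latent N C → ℝ} (hr : IsLatentPMF r) (n : Fin N) :
    ∑ n', bigOmega r n n' = 1 := by
  have := sum_bigOmega_mul r n fun _ => 1
  simpa [hr.sum_eq_one] using this

lemma trace_scatter (M : Model N dX dY) (r : Latent N C → ℝ) (L : Matrix (Fin dX) (Fin dX) ℝ) :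
    (Lᵀ * scatter M r * L).trace = (Lᵀ * M.Λ₀⁻¹ * L).trace +
      ∑ n, ∑ n', bigOmega r n n' * quad (M.x n - M.x n') (L * Lᵀ) := by
  rw [scatter, Matrix.mul_add, Matrix.add_mul, Matrix.trace_add]
  congr 1
  simp only [Finset.mul_sum, Finset.sum_mul, Matrix.trace_sum, Matrix.mul_smul, Matrix.smul_mul,
    Matrix.trace_smul, trace_transpose_mul_vecMulVec_mul, smul_eq_mul]

variable {Ω : Type*} [MeasurableSpace Ω] {P : Measure Ω}
  {A : Ω → Matrix (Fin dX) (Fin dX) ℝ} {M : Model N dX dY}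

lemma IsBartlett.aestronglyMeasurable_logSumSim (hA : IsBartlett P M.η₀ A) (n : Fin N)
    (L : Matrix (Fin dX) (Fin dX) ℝ) :
    AEStronglyMeasurable (fun ω => logSumSim M n L (A ω)) P := by
  have h := ((continuous_logSumQuad M n).comp continuous_symMat).measurable.comp_aemeasurable
    (hA.aemeasurable_symCoord L)
  refine (h.congr (ae_of_all _ fun ω => ?_)).aestronglyMeasurable
  rw [logSumSim_eq, Function.comp_apply, Function.comp_apply, symMat_symCoord]
  have := Matrix.isSymm_mul_transpose_self (L * A ω)
  rwa [Matrix.transpose_mul, ← Matrix.mul_assoc] at this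

lemma IsBartlett.integrable_logSumSim [IsProbabilityMeasure P]
    (hA : IsBartlett P M.η₀ A) (hM : M.Valid) (n : Fin N)
    (L : Matrix (Fin dX) (Fin dX) ℝ) : Integrable (fun ω => logSumSim M n L (A ω)) P := by
  refine Integrable.mono' (g := fun ω => Real.log (Fintype.card {n' : Fin N // n' ≠ n}) +
      ∑ n' : {n' : Fin N // n' ≠ n},
        |-(1 / 2) * quad (M.x n - M.x n') (L * A ω * (A ω)ᵀ * Lᵀ)|) ?_
    (hA.aestronglyMeasurable_logSumSim n L) (ae_of_all _ fun ω => ?_)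
  · exact (integrable_const _).add (integrable_finsetSum _ fun n' _ =>
      ((hA.integral_linear hM.η₀_gt (quad _) L).1.const_mul _).abs)
  · exact abs_logSumQuad_le M n _

/-- `E log ∑ exp` dominates the expected average of the exponents with weights `Ω_{nn'}`; this is
the part of the trace term of the objective that comes from the data. -/
lemma IsBartlett.neg_sum_le_integral_logSumSim [IsProbabilityMeasure P]
    (hA : IsBartlett P M.η₀ A) (hM : M.Valid)
    {r : Latent N C → ℝ} (hr : IsLatentPMF r) (n : Fin N) (L : Matrix (Fin dX) (Fin dX) ℝ) :
    -(M.η₀ / 2) * ∑ n', bigOmega r n n' * quad (M.x n - M.x n') (L * Lᵀ) ≤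
      ∫ ω, logSumSim M n L (A ω) ∂P := by
  have hint : ∀ n' : {n' : Fin N // n' ≠ n}, Integrable (fun ω =>
      bigOmega r n n' * (-(1 / 2) * quad (M.x n - M.x n') (L * A ω * (A ω)ᵀ * Lᵀ))) P := fun n' =>
    ((hA.integral_linear hM.η₀_gt (quad _) L).1.const_mul _).const_mul _
  have h1 : -(M.η₀ / 2) * ∑ n', bigOmega r n n' * quad (M.x n - M.x n') (L * Lᵀ) =
      ∫ ω, ∑ n' : {n' : Fin N // n' ≠ n},
        bigOmega r n n' * (-(1 / 2) * quad (M.x n - M.x n') (L * A ω * (A ω)ᵀ * Lᵀ)) ∂P := by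
    rw [integral_finsetSum _ fun n' _ => hint n', Finset.mul_sum]
    refine Finset.sum_congr rfl fun n' _ => ?_
    rw [integral_const_mul, integral_const_mul, (hA.integral_linear hM.η₀_gt (quad _) L).2]
    ring
  rw [h1]
  exact integral_mono (integrable_finsetSum _ fun n' _ => hint n')
    (hA.integrable_logSumSim hM n L) fun ω =>
      sum_mul_le_log_sum_exp (bigOmega_nonneg hr n) (sum_bigOmega hr n) _

lemma IsBartlett.le_objective [IsProbabilityMeasure P]
    (hA : IsBartlett P M.η₀ A) (hM : M.Valid)
    {r : Latent N C → ℝ} (hr : IsLatentPMF r) (L : Matrix (Fin dX) (Fin dX) ℝ) :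
    -M.η₀ * Real.log L.det + M.η₀ / 2 * (Lᵀ * M.Λ₀⁻¹ * L).trace ≤ objective M r P A L := by
  rw [objective, trace_scatter]
  have h := Finset.sum_le_sum fun n (_ : n ∈ Finset.univ) =>
    hA.neg_sum_le_integral_logSumSim hM hr n L
  rw [← Finset.mul_sum] at h
  linarith

end Objective

/-! ### Attainment of the minimum -/

section Continuity

variable {N C dX dY : ℕ} {Ω : Type*} [MeasurableSpace Ω] {P : Measure Ω} [IsProbabilityMeasure P]
  {A : Ω → Matrix (Fin dX) (Fin dX) ℝ} {M : Model N dX dY}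

lemma abs_quad_conj_le {d : ℕ} (v : Fin d → ℝ) {L X : Matrix (Fin d) (Fin d) ℝ} {R : ℝ}
    (hR : ∀ i j, |L i j| ≤ R) :
    |quad v (L * X * Lᵀ)| ≤ (∑ a, |v a|) ^ 2 * R ^ 2 * ∑ i, ∑ j, |X i j| := by
  rcases isEmpty_or_nonempty (Fin d) with h | ⟨⟨i₀⟩⟩
  · simp [quad, dotProduct]
  have hR0 : 0 ≤ R := (abs_nonneg _).trans (hR i₀ i₀)
  have hu : ∀ i, |(Lᵀ *ᵥ v) i| ≤ R * ∑ a, |v a| := by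
    intro i
    rw [Matrix.mulVec, dotProduct, Finset.mul_sum]
    refine (Finset.abs_sum_le_sum_abs _ _).trans (Finset.sum_le_sum fun a _ => ?_)
    rw [abs_mul]
    exact mul_le_mul_of_nonneg_right (hR a i) (abs_nonneg _)
  have hq : quad v (L * X * Lᵀ) = ∑ i, ∑ j, (Lᵀ *ᵥ v) i * X i j * (Lᵀ *ᵥ v) j := by
    have h1 : quad v (L * X * Lᵀ) = (Lᵀ *ᵥ v) ⬝ᵥ (X *ᵥ (Lᵀ *ᵥ v)) := by
      change v ⬝ᵥ ((L * X * Lᵀ) *ᵥ v) = _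
      rw [← Matrix.mulVec_mulVec, ← Matrix.mulVec_mulVec, Matrix.dotProduct_mulVec,
        ← Matrix.mulVec_transpose]
    rw [h1, dotProduct]
    refine Finset.sum_congr rfl fun i _ => ?_
    rw [show (X *ᵥ Lᵀ *ᵥ v) i = ∑ j, X i j * (Lᵀ *ᵥ v) j from rfl, Finset.mul_sum]
    exact Finset.sum_congr rfl fun j _ => (mul_assoc _ _ _).symm
  rw [hq, Finset.mul_sum]
  refine (Finset.abs_sum_le_sum_abs _ _).trans (Finset.sum_le_sum fun i _ => ?_)
  rw [Finset.mul_sum]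
  refine (Finset.abs_sum_le_sum_abs _ _).trans (Finset.sum_le_sum fun j _ => ?_)
  rw [abs_mul, abs_mul]
  calc |(Lᵀ *ᵥ v) i| * |X i j| * |(Lᵀ *ᵥ v) j|
      ≤ (R * ∑ a, |v a|) * |X i j| * (R * ∑ a, |v a|) := by
        have := hu i; have := hu j
        gcongr
    _ = _ := by ring

/-- Dominated convergence: near `L₀` the integrand is bounded by a constant plus a multiple of the
sum of the `|(A Aᵀ)_{ij}|`. -/
lemma IsBartlett.continuous_integral_logSumSim (hA : IsBartlett P M.η₀ A) (hM : M.Valid)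
    (n : Fin N) : Continuous fun L => ∫ ω, logSumSim M n L (A ω) ∂P := by
  have _ : FirstCountableTopology (Matrix (Fin dX) (Fin dX) ℝ) :=
    inferInstanceAs (FirstCountableTopology (Fin dX → Fin dX → ℝ))
  refine continuous_iff_continuousAt.mpr fun L₀ => ?_
  set R : ℝ := 1 + ∑ i, ∑ j, |L₀ i j| with hR
  have hnear : ∀ᶠ L in nhds L₀, ∀ i j, |L i j| ≤ R := by
    rw [Filter.eventually_all]
    intro i
    rw [Filter.eventually_all]
    intro j
    have hc : Continuous fun L : Matrix (Fin dX) (Fin dX) ℝ => |L i j| := by fun_prop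
    refine (hc.continuousAt.eventually_lt continuousAt_const ?_).mono fun L hL => hL.le
    have h1 : |L₀ i j| ≤ ∑ j, |L₀ i j| :=
      Finset.single_le_sum (f := fun j => |L₀ i j|) (fun _ _ => abs_nonneg _) (Finset.mem_univ j)
    have h2 : ∑ j, |L₀ i j| ≤ ∑ i, ∑ j, |L₀ i j| :=
      Finset.single_le_sum (f := fun i => ∑ j, |L₀ i j|)
        (fun _ _ => Finset.sum_nonneg fun _ _ => abs_nonneg _) (Finset.mem_univ i)
    linarith
  refine continuousAt_of_dominated (bound := fun ω =>
    Real.log (Fintype.card {n' : Fin N // n' ≠ n}) + ∑ n' : {n' : Fin N // n' ≠ n},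
      1 / 2 * ((∑ a, |(M.x n - M.x n') a|) ^ 2 * R ^ 2 * ∑ i, ∑ j, |(A ω * (A ω)ᵀ) i j|))
    (Filter.Eventually.of_forall fun L => hA.aestronglyMeasurable_logSumSim n L)
    (hnear.mono fun L hL => ae_of_all _ fun ω => ?_) ?_ (ae_of_all _ fun ω => ?_)
  · refine (abs_logSumQuad_le M n _).trans ?_
    gcongr with n'
    rw [abs_mul, abs_neg, abs_of_pos (by norm_num : (0 : ℝ) < 1 / 2), Matrix.mul_assoc L]
    have := abs_quad_conj_le (M.x n - M.x n') (X := A ω * (A ω)ᵀ) hL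
    gcongr
  · refine (integrable_const _).add (integrable_finsetSum _ fun n' _ => ?_)
    exact ((integrable_finsetSum _ fun i _ => integrable_finsetSum _ fun j _ =>
      (hA.integrable_mul_transpose hM.η₀_gt i j).abs).const_mul _).const_mul _
  · have hc : Continuous fun L : Matrix (Fin dX) (Fin dX) ℝ => L * A ω * (A ω)ᵀ * Lᵀ := by
      fun_prop
    exact ((continuous_logSumQuad M n).comp hc).continuousAt

lemma IsBartlett.continuousOn_objective (hA : IsBartlett P M.η₀ A) (hM : M.Valid)
    (r : Latent N C → ℝ) : ContinuousOn (objective M r P A) (choleskyFactors dX) := by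
  have h1 : ContinuousOn (fun L : Matrix (Fin dX) (Fin dX) ℝ => Real.log L.det)
      (choleskyFactors dX) :=
    ContinuousOn.log (Continuous.matrix_det continuous_id).continuousOn fun L hL =>
      (det_pos_of_mem_choleskyFactors hL).ne'
  have h2 : Continuous fun L => ∑ n : Fin N, ∫ ω, logSumSim M n L (A ω) ∂P :=
    continuous_finsetSum _ fun n _ => hA.continuous_integral_logSumSim hM n
  have h3 : Continuous fun L : Matrix (Fin dX) (Fin dX) ℝ => (Lᵀ * scatter M r * L).trace := by
    fun_prop
  exact ((continuousOn_const.mul h1).add h2.continuousOn).add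
    (continuousOn_const.mul h3.continuousOn)

end Continuity

section Coercivity

variable {d : ℕ}

/-- A positive definite matrix `B = U Uᵀ` has `tr (Lᵀ B L) = ‖Uᵀ L‖² ≥ c ‖L‖²` for the Frobenius
norm, with `c` the inverse of `1 + ‖(Uᵀ)⁻¹‖²`. -/
lemma exists_pos_mul_sum_sq_le_trace {B : Matrix (Fin d) (Fin d) ℝ} (hB : B.PosDef) :
    ∃ c > 0, ∀ L : Matrix (Fin d) (Fin d) ℝ,
      c * ∑ i, ∑ j, L i j ^ 2 ≤ (Lᵀ * B * L).trace := by
  obtain ⟨U, hU, rfl⟩ := exists_cholesky hB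
  have hu : IsUnit (Uᵀ).det := by
    rw [Matrix.det_transpose]
    exact (det_pos_of_mem_choleskyFactors hU).ne'.isUnit
  set V := (Uᵀ)⁻¹ with hV
  set F : ℝ := ∑ i, ∑ k, V i k ^ 2 with hF
  have hF0 : 0 ≤ F := Finset.sum_nonneg fun _ _ => Finset.sum_nonneg fun _ _ => sq_nonneg _
  refine ⟨(1 + F)⁻¹, by positivity, fun L => ?_⟩
  set W := Uᵀ * L with hW
  have htr : (Lᵀ * (U * Uᵀ) * L).trace = ∑ j, ∑ k, W k j ^ 2 := by
    have : Lᵀ * (U * Uᵀ) * L = Wᵀ * W := by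
      rw [hW, Matrix.transpose_mul, Matrix.transpose_transpose]
      simp only [Matrix.mul_assoc]
    rw [this, Matrix.trace]
    refine Finset.sum_congr rfl fun j _ => ?_
    rw [Matrix.diag_apply, Matrix.mul_apply]
    exact Finset.sum_congr rfl fun k _ => (sq _).symm
  have hW0 : 0 ≤ ∑ j, ∑ k, W k j ^ 2 :=
    Finset.sum_nonneg fun _ _ => Finset.sum_nonneg fun _ _ => sq_nonneg _
  have hL : L = V * W := by
    rw [hW, ← Matrix.mul_assoc, hV, Matrix.nonsing_inv_mul _ hu, Matrix.one_mul]
  have hle : ∑ i, ∑ j, L i j ^ 2 ≤ F * ∑ j, ∑ k, W k j ^ 2 := by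
    rw [hF, Finset.sum_mul]
    refine Finset.sum_le_sum fun i _ => ?_
    rw [Finset.mul_sum]
    refine Finset.sum_le_sum fun j _ => ?_
    rw [hL, Matrix.mul_apply]
    exact Finset.sum_mul_sq_le_sq_mul_sq _ _ _
  rw [htr, inv_mul_le_iff₀ (by positivity)]
  linarith

lemma isCompact_boundedLower (d : ℕ) (ε R : ℝ) :
    IsCompact {L : Matrix (Fin d) (Fin d) ℝ |
      (∀ i j, i < j → L i j = 0) ∧ (∀ i, ε ≤ L i i) ∧ ∀ i j, |L i j| ≤ R} := by
  have hbox : IsCompact (Set.univ.pi fun _ : Fin d => Set.univ.pi fun _ : Fin d =>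
      Set.Icc (-R) R) := isCompact_univ_pi fun _ => isCompact_univ_pi fun _ => isCompact_Icc
  have hcl : IsClosed {L : Matrix (Fin d) (Fin d) ℝ |
      (∀ i j, i < j → L i j = 0) ∧ (∀ i, ε ≤ L i i) ∧ ∀ i j, |L i j| ≤ R} := by
    have hent : ∀ i j, Continuous fun L : Matrix (Fin d) (Fin d) ℝ => L i j := fun i j => by
      fun_prop
    refine IsClosed.and ?_ (IsClosed.and ?_ ?_)
    · simp only [Set.ofPred_forall]
      exact isClosed_iInter fun i => isClosed_iInter fun j => isClosed_iInter fun _ =>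
        isClosed_eq (hent i j) continuous_const
    · simp only [Set.ofPred_forall]
      exact isClosed_iInter fun i => isClosed_le continuous_const (hent i i)
    · simp only [Set.ofPred_forall]
      exact isClosed_iInter fun i => isClosed_iInter fun j =>
        isClosed_le (hent i j).abs continuous_const
  exact hbox.of_isClosed_subset hcl fun L hL i _ j _ => abs_le.mp (hL.2.2 i j)

/-- `a t² - η log t` is bounded below on `t > 0`, by `log y ≤ y - 1` at `y = 2 a t² / η`. -/
lemma const_le_mul_sq_sub_log {η a t : ℝ} (hη : 0 < η) (ha : 0 < a) (ht : 0 < t) :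
    η / 2 * (1 + Real.log (2 * a / η)) ≤ a * t ^ 2 - η * Real.log t := by
  have h1 := Real.log_le_sub_one_of_pos (x := 2 * a / η * t ^ 2) (by positivity)
  rw [Real.log_mul (by positivity) (by positivity), Real.log_pow] at h1
  have h2 := mul_le_mul_of_nonneg_left h1 (half_pos hη).le
  have h3 : η / 2 * (2 * a / η * t ^ 2 - 1) = a * t ^ 2 - η / 2 := by field_simp
  rw [h3] at h2
  push_cast at h2
  linarith

/-- A continuous function on the Cholesky factors attains its minimum once it dominates
`-η log det L + 2 a ‖L‖²`: this barrier tends to infinity both at infinity and where a diagonal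
entry tends to zero, so that the sublevel set of the identity lies in a compact set of Cholesky
factors. -/
lemma exists_isMinOn_choleskyFactors {J : Matrix (Fin d) (Fin d) ℝ → ℝ}
    (hJ : ContinuousOn J (choleskyFactors d)) {η a : ℝ} (hη : 0 < η) (ha : 0 < a)
    (hle : ∀ L ∈ choleskyFactors d,
      -η * Real.log L.det + 2 * a * ∑ i, ∑ j, L i j ^ 2 ≤ J L) :
    ∃ L ∈ choleskyFactors d, IsMinOn J (choleskyFactors d) L := by
  -- half of the quadratic part keeps the diagonal terms above `m`; the other half bounds `‖L‖`
  set m : ℝ := η / 2 * (1 + Real.log (2 * a / η)) with hm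
  set b : ℝ := J 1 - d * m with hb
  set ε : ℝ := min 1 (Real.exp (-((b + m) / η))) with hε
  set R : ℝ := max 1 (√(b / a)) with hR
  set K : Set (Matrix (Fin d) (Fin d) ℝ) :=
    {L | (∀ i j, i < j → L i j = 0) ∧ (∀ i, ε ≤ L i i) ∧ ∀ i j, |L i j| ≤ R} with hK
  have hε0 : 0 < ε := lt_min one_pos (Real.exp_pos _)
  have hKsub : K ⊆ choleskyFactors d := fun L hL => ⟨hL.1, fun i => hε0.trans_le (hL.2.1 i)⟩
  have hone : (1 : Matrix (Fin d) (Fin d) ℝ) ∈ K := by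
    refine ⟨(one_mem_choleskyFactors d).1, fun i => ?_, fun i j => ?_⟩
    · rw [Matrix.one_apply_eq]
      exact min_le_left _ _
    · rw [Matrix.one_apply]
      refine le_trans ?_ (le_max_left _ _)
      split_ifs <;> simp
  obtain ⟨L, hL, hmin⟩ := (isCompact_boundedLower d ε R).exists_isMinOn ⟨1, hone⟩ (hJ.mono hKsub)
  refine ⟨L, hKsub hL, fun T hT => ?_⟩
  by_cases hTJ : J 1 < J T
  · exact (hmin hone).trans hTJ.le
  refine hmin ?_
  have hbar := (hle T hT).trans (not_lt.mp hTJ)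
  have hsq : ∑ i, T i i ^ 2 ≤ ∑ i, ∑ j, T i j ^ 2 := Finset.sum_le_sum fun i _ =>
    Finset.single_le_sum (f := fun j => T i j ^ 2) (fun _ _ => sq_nonneg _) (Finset.mem_univ i)
  have hlog : Real.log T.det = ∑ i, Real.log (T i i) := by
    rw [det_of_lower hT.1, Real.log_prod fun i _ => (hT.2 i).ne']
  have hterm : ∀ i, m ≤ a * T i i ^ 2 - η * Real.log (T i i) := fun i =>
    const_le_mul_sq_sub_log hη ha (hT.2 i)
  have hsum : ∑ i, (a * T i i ^ 2 - η * Real.log (T i i)) + a * ∑ i, ∑ j, T i j ^ 2 ≤ J 1 := by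
    rw [Finset.sum_sub_distrib, ← Finset.mul_sum, ← Finset.mul_sum, ← hlog]
    have := mul_le_mul_of_nonneg_left hsq ha.le
    linarith
  have hF0 : 0 ≤ ∑ i, ∑ j, T i j ^ 2 :=
    Finset.sum_nonneg fun _ _ => Finset.sum_nonneg fun _ _ => sq_nonneg _
  have hsum' : ∑ i, (a * T i i ^ 2 - η * Real.log (T i i) - m) + a * ∑ i, ∑ j, T i j ^ 2 ≤ b := by
    rw [Finset.sum_sub_distrib, Finset.sum_const, Finset.card_univ, Fintype.card_fin,
      nsmul_eq_mul]
    linarith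
  have hnonneg : ∀ i, 0 ≤ a * T i i ^ 2 - η * Real.log (T i i) - m := fun i =>
    sub_nonneg.mpr (hterm i)
  refine ⟨hT.1, fun i => ?_, fun i j => ?_⟩
  · have h1 := Finset.single_le_sum
      (f := fun i => a * T i i ^ 2 - η * Real.log (T i i) - m) (fun i _ => hnonneg i)
      (Finset.mem_univ i)
    have h2 : -((b + m) / η) ≤ Real.log (T i i) := by
      rw [neg_le, ← sub_nonneg]
      have h3 : 0 ≤ a * ∑ i, ∑ j, T i j ^ 2 := by positivity
      have h4 : 0 ≤ a * T i i ^ 2 := by positivity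
      have h5 : -(η * Real.log (T i i)) ≤ b + m := by
        linarith
      rw [sub_nonneg, le_div_iff₀ hη]
      linarith
    refine (min_le_right _ _).trans ?_
    rw [← Real.le_log_iff_exp_le (hT.2 i)]
    exact h2
  · refine le_trans ?_ (le_max_right _ _)
    rw [← Real.sqrt_sq_eq_abs]
    refine Real.sqrt_le_sqrt ?_
    rw [le_div_iff₀ ha, mul_comm]
    have h1 : T i j ^ 2 ≤ ∑ j, T i j ^ 2 :=
      Finset.single_le_sum (f := fun j => T i j ^ 2) (fun _ _ => sq_nonneg _) (Finset.mem_univ j)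
    have h2 : ∑ j, T i j ^ 2 ≤ ∑ i, ∑ j, T i j ^ 2 :=
      Finset.single_le_sum (f := fun i => ∑ j, T i j ^ 2)
        (fun _ _ => Finset.sum_nonneg fun _ _ => sq_nonneg _) (Finset.mem_univ i)
    have h3 : 0 ≤ ∑ i, (a * T i i ^ 2 - η * Real.log (T i i) - m) :=
      Finset.sum_nonneg fun i _ => hnonneg i
    have h4 := mul_le_mul_of_nonneg_left (h1.trans h2) ha.le
    linarith

end Coercivity

section Minimum

variable {N C dX dY : ℕ} {Ω : Type*} [MeasurableSpace Ω] {P : Measure Ω} [IsProbabilityMeasure P]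
  {A : Ω → Matrix (Fin dX) (Fin dX) ℝ} {M : Model N dX dY}

lemma IsBartlett.exists_isMinOn_objective (hA : IsBartlett P M.η₀ A) (hM : M.Valid)
    {r : Latent N C → ℝ} (hr : IsLatentPMF r) :
    ∃ L ∈ choleskyFactors dX, IsMinOn (objective M r P A) (choleskyFactors dX) L := by
  rcases isEmpty_or_nonempty (Fin dX) with h | ⟨⟨i⟩⟩
  -- in dimension zero there is only one matrix, while `η₀` need not be positive
  · refine ⟨1, one_mem_choleskyFactors dX, fun L _ => ?_⟩
    rw [Set.mem_ofPred_eq, Subsingleton.elim L 1]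
  have hη : 0 < M.η₀ := (sub_natCast_pos hM.η₀_gt i).trans_le (by simp)
  obtain ⟨c, hc, hcL⟩ := exists_pos_mul_sum_sq_le_trace hM.Λ₀_posDef.inv
  refine exists_isMinOn_choleskyFactors (hA.continuousOn_objective hM r) hη
    (a := M.η₀ * c / 4) (by positivity) fun L _ => (hA.le_objective hM hr L).trans' ?_
  have := mul_le_mul_of_nonneg_left (hcL L) (half_pos hη).le
  linarith

end Minimum

/-! ### Expectations under the Wishart density -/

section WishartExpectation

variable {d : ℕ} {ν : ℝ}

lemma wishartPDF_pos (hν : (d : ℝ) - 1 < ν) {S X : Matrix (Fin d) (Fin d) ℝ} (hS : S.PosDef)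
    (hX : X.PosDef) : 0 < wishartPDF S ν X := by
  have h1 := multiGamma_pos hν
  have h2 := hS.det_pos
  have h3 := hX.det_pos
  rw [wishartPDF, if_pos hX]
  positivity

lemma wishartPDF_nonneg (hν : (d : ℝ) - 1 < ν) {S : Matrix (Fin d) (Fin d) ℝ} (hS : S.PosDef)
    (X : Matrix (Fin d) (Fin d) ℝ) : 0 ≤ wishartPDF S ν X := by
  by_cases hX : X.PosDef
  · exact (wishartPDF_pos hν hS hX).le
  · rw [wishartPDF, if_neg hX]

lemma posDef_of_wishartPDF_ne_zero {S X : Matrix (Fin d) (Fin d) ℝ} (h : wishartPDF S ν X ≠ 0) :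
    X.PosDef := by
  by_contra hX
  exact h (by rw [wishartPDF, if_neg hX])

lemma log_wishartPDF (hν : (d : ℝ) - 1 < ν) {S X : Matrix (Fin d) (Fin d) ℝ} (hS : S.PosDef)
    (hX : X.PosDef) :
    Real.log (wishartPDF S ν X) = -Real.log (2 ^ (ν * d / 2) * multiGamma d (ν / 2)) -
      ν / 2 * Real.log S.det + (ν - d - 1) / 2 * Real.log X.det - (S⁻¹ * X).trace / 2 := by
  have h1 := multiGamma_pos hν
  have h2 := hS.det_pos
  have h3 := hX.det_pos
  have h4 : (0 : ℝ) < 2 ^ (ν * d / 2) := by positivity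
  rw [wishartPDF, if_pos hX, Real.log_mul (by positivity) (by positivity),
    Real.log_mul (by positivity) (by positivity), Real.log_exp, Real.log_rpow h3, one_div,
    Real.log_inv, Real.log_mul (by positivity) h1.ne', Real.log_mul (by positivity) (by positivity),
    Real.log_rpow h2, Real.log_mul (by positivity) h1.ne']
  ring

lemma measurable_wishartPDF_symMat (S : Matrix (Fin d) (Fin d) ℝ) (ν : ℝ) :
    Measurable fun v : SymCoord d => wishartPDF S ν (symMat v) := by
  have hdet : Measurable fun v : SymCoord d => (symMat v).det :=
    (Continuous.matrix_det continuous_symMat).measurable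
  have htr : Measurable fun v : SymCoord d => (S⁻¹ * symMat v).trace :=
    (Continuous.matrix_trace (continuous_const.matrix_mul continuous_symMat)).measurable
  exact Measurable.ite measurableSet_posDef
    (((hdet.pow_const _).const_mul _).mul ((htr.neg.div_const 2).exp)) measurable_const

variable {Ω : Type*} [MeasurableSpace Ω] {P : Measure Ω} [IsProbabilityMeasure P]
  {A : Ω → Matrix (Fin d) (Fin d) ℝ}

/-- Expectations under the Wishart density are expectations of functions of `L A Aᵀ Lᵀ`. -/
lemma IsBartlett.integral_wishartPDF_mul (hA : IsBartlett P ν A) (hν : (d : ℝ) - 1 < ν)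
    {L : Matrix (Fin d) (Fin d) ℝ} (hL : L ∈ choleskyFactors d)
    {h : Matrix (Fin d) (Fin d) ℝ → ℝ} (hc : Continuous h)
    (hint : Integrable (fun ω => h (L * A ω * (A ω)ᵀ * Lᵀ)) P) :
    Integrable (fun v : SymCoord d => wishartPDF (L * Lᵀ) ν (symMat v) * h (symMat v)) ∧
      ∫ v : SymCoord d, wishartPDF (L * Lᵀ) ν (symMat v) * h (symMat v) =
        ∫ ω, h (L * A ω * (A ω)ᵀ * Lᵀ) ∂P := by
  have hS := posDef_mul_transpose hL
  have hmeas : Measurable fun v : SymCoord d => (wishartPDF (L * Lᵀ) ν (symMat v)).toNNReal :=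
    (measurable_wishartPDF_symMat _ ν).real_toNNReal
  have hsymm : ∀ ω, symMat (symCoord (L * A ω * (A ω)ᵀ * Lᵀ)) = L * A ω * (A ω)ᵀ * Lᵀ := by
    intro ω
    have := Matrix.isSymm_mul_transpose_self (L * A ω)
    rw [Matrix.transpose_mul, ← Matrix.mul_assoc] at this
    exact symMat_symCoord this
  have hsmul : ∀ v : SymCoord d, (wishartPDF (L * Lᵀ) ν (symMat v)).toNNReal • h (symMat v) =
      wishartPDF (L * Lᵀ) ν (symMat v) * h (symMat v) := fun v => by
    rw [NNReal.smul_def, Real.coe_toNNReal _ (wishartPDF_nonneg hν hS _), smul_eq_mul]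
  have hcont : AEStronglyMeasurable (fun v : SymCoord d => h (symMat v))
      (P.map fun ω => symCoord (L * A ω * (A ω)ᵀ * Lᵀ)) :=
    (hc.comp continuous_symMat).aestronglyMeasurable
  have hlaw : P.map (fun ω => symCoord (L * A ω * (A ω)ᵀ * Lᵀ)) = volume.withDensity
      fun v => ((wishartPDF (L * Lᵀ) ν (symMat v)).toNNReal : ENNReal) :=
    hA.map_eq_wishartMeasure hν hL
  constructor
  · have h1 : Integrable (fun v : SymCoord d => h (symMat v))
        (P.map fun ω => symCoord (L * A ω * (A ω)ᵀ * Lᵀ)) := by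
      rw [integrable_map_measure hcont (hA.aemeasurable_symCoord L)]
      exact hint.congr (ae_of_all _ fun ω => by rw [Function.comp_apply, hsymm])
    rw [hlaw, integrable_withDensity_iff_integrable_smul hmeas] at h1
    exact h1.congr (ae_of_all _ hsmul)
  · calc _ = ∫ v : SymCoord d, (wishartPDF (L * Lᵀ) ν (symMat v)).toNNReal • h (symMat v) :=
          integral_congr_ae (ae_of_all _ fun v => (hsmul v).symm)
      _ = ∫ v, h (symMat v) ∂(P.map fun ω => symCoord (L * A ω * (A ω)ᵀ * Lᵀ)) := by
          rw [hlaw, integral_withDensity_eq_integral_smul hmeas]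
      _ = _ := by
          rw [integral_map (hA.aemeasurable_symCoord L) hcont]
          simp_rw [hsymm]

/-- The Wishart density is normalized. -/
lemma IsBartlett.integral_wishartPDF (hA : IsBartlett P ν A) (hν : (d : ℝ) - 1 < ν)
    {L : Matrix (Fin d) (Fin d) ℝ} (hL : L ∈ choleskyFactors d) :
    Integrable (fun v : SymCoord d => wishartPDF (L * Lᵀ) ν (symMat v)) ∧
      ∫ v : SymCoord d, wishartPDF (L * Lᵀ) ν (symMat v) = 1 := by
  have h := hA.integral_wishartPDF_mul hν hL (h := fun _ => 1) continuous_const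
    (integrable_const 1)
  simpa using h

end WishartExpectation

/-! ### The evidence lower bound -/

section ELBO

variable {N C dX dY : ℕ}

lemma normalPDF_pos {d : ℕ} {S : Matrix (Fin d) (Fin d) ℝ} (hS : S.PosDef) (m x : Fin d → ℝ) :
    0 < normalPDF m S x := by
  have := hS.det_pos
  have := Real.pi_pos
  unfold normalPDF
  positivity

lemma invWishartPDF_pos {d : ℕ} {ν : ℝ} (hν : (d : ℝ) - 1 < ν) {S X : Matrix (Fin d) (Fin d) ℝ}
    (hS : S.PosDef) (hX : X.PosDef) : 0 < invWishartPDF S ν X := by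
  have h1 := multiGamma_pos hν
  have h2 := hS.det_pos
  have h3 := hX.det_pos
  rw [invWishartPDF, if_pos hX]
  positivity

/-- The normalizing constants of the normal densities cancel in the first transition. -/
lemma firstTransition_eq (M : Model N dX dY) {X : Matrix (Fin dX) (Fin dX) ℝ} (hX : X.PosDef)
    (n : Fin N) (n' : {n' : Fin N // n' ≠ n}) :
    firstTransition M X n n' = Real.exp (-(1 / 2) * quad (M.x n - M.x n') X) /
      ∑ n'' : {n' : Fin N // n' ≠ n}, Real.exp (-(1 / 2) * quad (M.x n - M.x n'') X) := by
  have hdet := hX.inv.det_pos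
  have hpi := Real.pi_pos
  have h : ∀ k : {n' : Fin N // n' ≠ n}, normalPDF (M.x k) X⁻¹ (M.x n) =
      ((2 * Real.pi) ^ (-(dX : ℝ) / 2) * (X⁻¹).det ^ (-(1 : ℝ) / 2)) *
        Real.exp (-(1 / 2) * quad (M.x n - M.x k) X) := by
    intro k
    rw [normalPDF, Matrix.nonsing_inv_nonsing_inv X hX.det_pos.ne'.isUnit]
    rfl
  rw [firstTransition]
  simp_rw [h]
  rw [← Finset.mul_sum, mul_div_mul_left _ _ (by positivity)]

lemma firstTransition_pos (M : Model N dX dY) {X : Matrix (Fin dX) (Fin dX) ℝ} (hX : X.PosDef)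
    (n : Fin N) (n' : {n' : Fin N // n' ≠ n}) : 0 < firstTransition M X n n' := by
  rw [firstTransition_eq M hX]
  exact div_pos (Real.exp_pos _)
    (Finset.sum_pos (fun _ _ => Real.exp_pos _) ⟨n', Finset.mem_univ _⟩)

lemma log_firstTransition (M : Model N dX dY) {X : Matrix (Fin dX) (Fin dX) ℝ} (hX : X.PosDef)
    (n : Fin N) (n' : {n' : Fin N // n' ≠ n}) :
    Real.log (firstTransition M X n n') =
      -(1 / 2) * quad (M.x n - M.x n') X - logSumQuad M n X := by
  rw [firstTransition_eq M hX, Real.log_div (Real.exp_pos _).ne' (ne_of_gt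
    (Finset.sum_pos (fun _ _ => Real.exp_pos _) ⟨n', Finset.mem_univ _⟩)), Real.log_exp]
  rfl

lemma secondTransition_pos (M : Model N dX dY) {m : Experts C dY}
    (hm : ∀ c, (symMat (m c).2).PosDef) (n' : Fin N) (c : Fin C) :
    0 < secondTransition M m n' c :=
  div_pos (normalPDF_pos (hm c) _ _)
    (Finset.sum_pos (fun c' _ => normalPDF_pos (hm c') _ _) ⟨c, Finset.mem_univ _⟩)

/-- The part of the pseudojoint that does not involve `Λ`. -/
noncomputable def expertFactor (M : Model N dX dY) (m : Experts C dY) (w : Latent N C) : ℝ :=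
  (∏ n, secondTransition M m ((w n).1 : Fin N) (w n).2 *
    normalPDF (m (w n).2).1 (symMat (m (w n).2).2) (M.y n)) *
  ∏ c : Fin C, (normalPDF M.μ₀ ((1 / M.κ₀) • symMat (m c).2) (m c).1 *
      invWishartPDF M.S₀ M.ν₀ (symMat (m c).2))

lemma expertFactor_pos {M : Model N dX dY} (hM : M.Valid) {m : Experts C dY}
    (hm : ∀ c, (symMat (m c).2).PosDef) (w : Latent N C) : 0 < expertFactor M m w := by
  refine mul_pos (Finset.prod_pos fun n _ => ?_) (Finset.prod_pos fun c _ => ?_)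
  · exact mul_pos (secondTransition_pos M hm _ _) (normalPDF_pos (hm _) _ _)
  · exact mul_pos (normalPDF_pos ((hm c).smul (one_div_pos.mpr hM.κ₀_pos)) _ _)
      (invWishartPDF_pos hM.ν₀_gt hM.S₀_posDef (hm c))

lemma pseudoJoint_eq (M : Model N dX dY) (θ : Param C dX dY) (w : Latent N C) :
    pseudoJoint M θ w = (∏ n, firstTransition M (symMat θ.1) n (w n).1) *
      wishartPDF M.Λ₀ M.η₀ (symMat θ.1) * expertFactor M θ.2 w := by
  have h : ∏ n, fullConditional M θ n (w n) =
      (∏ n, firstTransition M (symMat θ.1) n (w n).1) *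
        ∏ n, secondTransition M θ.2 ((w n).1 : Fin N) (w n).2 *
          normalPDF (θ.2 (w n).2).1 (symMat (θ.2 (w n).2).2) (M.y n) := by
    rw [← Finset.prod_mul_distrib]
    exact Finset.prod_congr rfl fun n _ => mul_assoc _ _ _
  rw [pseudoJoint, h, prior, expertFactor]
  ring

/-- The part of `log (p / q)` that involves `Λ`. The powers of `det Λ` of the Wishart prior and of
the Wishart factor of `q` cancel. -/
noncomputable def gateLog (M : Model N dX dY) (S : Matrix (Fin dX) (Fin dX) ℝ) (w : Latent N C)
    (X : Matrix (Fin dX) (Fin dX) ℝ) : ℝ :=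
  (∑ n, (-(1 / 2) * quad (M.x n - M.x (w n).1) X - logSumQuad M n X)) +
    (M.η₀ / 2 * (Real.log S.det - Real.log M.Λ₀.det) + (1 / 2) * (S⁻¹ * X).trace -
      (1 / 2) * (M.Λ₀⁻¹ * X).trace)

/-- The part of `log (p / q)` that does not involve `Λ`. -/
noncomputable def expertLog (M : Model N dX dY) (g : Experts C dY → ℝ) (r : Latent N C → ℝ)
    (w : Latent N C) (m : Experts C dY) : ℝ :=
  Real.log (expertFactor M m w) - Real.log (g m) - Real.log (r w)

lemma continuous_gateLog (M : Model N dX dY) (S : Matrix (Fin dX) (Fin dX) ℝ) (w : Latent N C) :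
    Continuous (gateLog M S w) := by
  refine (continuous_finsetSum _ fun n _ =>
    (continuous_const.mul (continuous_quad _)).sub (continuous_logSumQuad M n)).add ?_
  fun_prop

/-- The integrand separates into a gate part and an expert part. Where one of the factors of `q`
vanishes, both sides are zero; elsewhere all matrices are positive definite and all factors of `p`
are positive. -/
lemma elboIntegrand_varDensity {M : Model N dX dY} (hM : M.Valid) {g : Experts C dY → ℝ}
    (hg : IsExpertsPDF g) (r : Latent N C → ℝ) {S : Matrix (Fin dX) (Fin dX) ℝ}
    (hS : S.PosDef) (w : Latent N C) (θ : Param C dX dY) :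
    elboIntegrand M (varDensity M g r S) w θ =
      r w * ((wishartPDF S M.η₀ (symMat θ.1) * gateLog M S w (symMat θ.1)) * g θ.2) +
        r w * (wishartPDF S M.η₀ (symMat θ.1) * (g θ.2 * expertLog M g r w θ.2)) := by
  rw [elboIntegrand, varDensity]
  by_cases hW : wishartPDF S M.η₀ (symMat θ.1) = 0
  · simp [hW]
  by_cases hgm : g θ.2 = 0
  · simp [hgm]
  by_cases hrw : r w = 0
  · simp [hrw]
  have hX := posDef_of_wishartPDF_ne_zero hW
  have hm := hg.support _ hgm
  have hE := expertFactor_pos hM hm w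
  have hW₀ := wishartPDF_pos hM.η₀_gt hM.Λ₀_posDef hX
  have hFT : ∀ n, 0 < firstTransition M (symMat θ.1) n (w n).1 := fun n =>
    firstTransition_pos M hX n _
  have hprod : 0 < ∏ n, firstTransition M (symMat θ.1) n (w n).1 :=
    Finset.prod_pos fun n _ => hFT n
  have hlog : Real.log (pseudoJoint M θ w / (wishartPDF S M.η₀ (symMat θ.1) * g θ.2 * r w)) =
      gateLog M S w (symMat θ.1) + expertLog M g r w θ.2 := by
    rw [pseudoJoint_eq, Real.log_div (by positivity) (mul_ne_zero (mul_ne_zero hW hgm) hrw),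
      Real.log_mul (by positivity) hE.ne', Real.log_mul hprod.ne' hW₀.ne',
      Real.log_mul (mul_ne_zero hW hgm) hrw, Real.log_mul hW hgm,
      Real.log_prod fun n _ => (hFT n).ne', log_wishartPDF hM.η₀_gt hM.Λ₀_posDef hX,
      log_wishartPDF hM.η₀_gt hS hX, gateLog, expertLog]
    simp_rw [log_firstTransition M hX]
    ring
  rw [hlog]
  ring

lemma IsExpertsPDF.integrable {g : Experts C dY → ℝ} (hg : IsExpertsPDF g) : Integrable g := by
  by_contra h
  exact one_ne_zero (hg.integral_eq_one.symm.trans (integral_undef h))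

variable {Ω : Type*} [MeasurableSpace Ω] {P : Measure Ω} [IsProbabilityMeasure P]
  {A : Ω → Matrix (Fin dX) (Fin dX) ℝ} {M : Model N dX dY}

/-- The expectation of the gate part. By linearity it is explicit up to the log-sum-exp terms. -/
lemma IsBartlett.integral_gateLog (hA : IsBartlett P M.η₀ A) (hM : M.Valid) (w : Latent N C)
    {L : Matrix (Fin dX) (Fin dX) ℝ} (hL : L ∈ choleskyFactors dX) :
    Integrable (fun ω => gateLog M (L * Lᵀ) w (L * A ω * (A ω)ᵀ * Lᵀ)) P ∧
      ∫ ω, gateLog M (L * Lᵀ) w (L * A ω * (A ω)ᵀ * Lᵀ) ∂P =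
        -(M.η₀ / 2) * ∑ n, quad (M.x n - M.x (w n).1) (L * Lᵀ) -
          ∑ n, ∫ ω, logSumSim M n L (A ω) ∂P + M.η₀ * Real.log L.det -
          M.η₀ / 2 * (Lᵀ * M.Λ₀⁻¹ * L).trace + M.η₀ / 2 * (dX - Real.log M.Λ₀.det) := by
  let tr (B : Matrix (Fin dX) (Fin dX) ℝ) : Matrix (Fin dX) (Fin dX) ℝ →ₗ[ℝ] ℝ :=
    (Matrix.traceLinearMap (Fin dX) ℝ ℝ) ∘ₗ LinearMap.mulLeft ℝ B
  have hlin := fun φ => hA.integral_linear hM.η₀_gt φ L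
  have hsum : ∀ n, Integrable (fun ω =>
      -(1 / 2) * quad (M.x n - M.x (w n).1) (L * A ω * (A ω)ᵀ * Lᵀ) -
        logSumQuad M n (L * A ω * (A ω)ᵀ * Lᵀ)) P := fun n =>
    ((hlin _).1.const_mul _).sub (hA.integrable_logSumSim hM n L)
  have hS : Integrable (fun ω => (1 / 2) * ((L * Lᵀ)⁻¹ * (L * A ω * (A ω)ᵀ * Lᵀ)).trace) P :=
    (hlin (tr _)).1.const_mul _
  have hΛ : Integrable (fun ω => (1 / 2) * (M.Λ₀⁻¹ * (L * A ω * (A ω)ᵀ * Lᵀ)).trace) P :=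
    (hlin (tr _)).1.const_mul _
  have hconst : Integrable (fun _ : Ω =>
      M.η₀ / 2 * (Real.log (L * Lᵀ).det - Real.log M.Λ₀.det)) P := integrable_const _
  have hconstS : Integrable (fun ω => M.η₀ / 2 * (Real.log (L * Lᵀ).det - Real.log M.Λ₀.det) +
      (1 / 2) * ((L * Lᵀ)⁻¹ * (L * A ω * (A ω)ᵀ * Lᵀ)).trace) P := hconst.add hS
  have hrest : Integrable (fun ω => M.η₀ / 2 * (Real.log (L * Lᵀ).det - Real.log M.Λ₀.det) +
      (1 / 2) * ((L * Lᵀ)⁻¹ * (L * A ω * (A ω)ᵀ * Lᵀ)).trace -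
      (1 / 2) * (M.Λ₀⁻¹ * (L * A ω * (A ω)ᵀ * Lᵀ)).trace) P := hconstS.sub hΛ
  have hsums := integrable_finsetSum Finset.univ fun n _ => hsum n
  refine ⟨hsums.add hrest, ?_⟩
  have e1 : ∫ ω, (M.η₀ / 2 * (Real.log (L * Lᵀ).det - Real.log M.Λ₀.det) +
      (1 / 2) * ((L * Lᵀ)⁻¹ * (L * A ω * (A ω)ᵀ * Lᵀ)).trace -
      (1 / 2) * (M.Λ₀⁻¹ * (L * A ω * (A ω)ᵀ * Lᵀ)).trace) ∂P =
      M.η₀ / 2 * (Real.log (L * Lᵀ).det - Real.log M.Λ₀.det) +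
      (1 / 2) * (M.η₀ * ((L * Lᵀ)⁻¹ * (L * Lᵀ)).trace) -
      (1 / 2) * (M.η₀ * (M.Λ₀⁻¹ * (L * Lᵀ)).trace) := by
    have htrace : ∀ B : Matrix (Fin dX) (Fin dX) ℝ,
        ∫ ω, (B * (L * A ω * (A ω)ᵀ * Lᵀ)).trace ∂P = M.η₀ * (B * (L * Lᵀ)).trace := fun B =>
      (hlin (tr B)).2
    rw [integral_sub hconstS hΛ, integral_add hconst hS, integral_const,
      probReal_univ, one_smul, integral_const_mul, integral_const_mul, htrace, htrace]
  have e2 : ∀ n, ∫ ω, (-(1 / 2) * quad (M.x n - M.x (w n).1) (L * A ω * (A ω)ᵀ * Lᵀ) -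
      logSumQuad M n (L * A ω * (A ω)ᵀ * Lᵀ)) ∂P =
      -(M.η₀ / 2) * quad (M.x n - M.x (w n).1) (L * Lᵀ) - ∫ ω, logSumSim M n L (A ω) ∂P := by
    intro n
    simp only [← logSumSim_eq]
    rw [integral_sub ((hlin _).1.const_mul _) (hA.integrable_logSumSim hM n L),
      integral_const_mul, (hlin _).2]
    ring
  have hdet : Real.log (L * Lᵀ).det = 2 * Real.log L.det := by
    rw [Matrix.det_mul, Matrix.det_transpose, ← sq, Real.log_pow]
    norm_num
  have hinv : ((L * Lᵀ)⁻¹ * (L * Lᵀ)).trace = dX := by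
    rw [Matrix.nonsing_inv_mul _ (posDef_mul_transpose hL).det_pos.ne'.isUnit, Matrix.trace_one,
      Fintype.card_fin]
  have htr : (M.Λ₀⁻¹ * (L * Lᵀ)).trace = (Lᵀ * M.Λ₀⁻¹ * L).trace := by
    rw [← Matrix.mul_assoc, Matrix.trace_mul_comm, Matrix.mul_assoc]
  simp only [gateLog]
  rw [integral_add hsums hrest, integral_finsetSum _ fun n _ => hsum n, e1,
    Finset.sum_congr rfl fun n _ => e2 n, Finset.sum_sub_distrib, ← Finset.mul_sum, hdet, hinv,
    htr]
  ring

/-- The expectation of the expert part is finite as soon as the evidence lower bound is finite for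
one scale matrix `L Lᵀ`: subtracting the integrable gate part leaves a product of the Wishart
density and a function of the expert parameters, which is integrable along some slice where the
Wishart density is not zero. -/
lemma IsBartlett.integrable_expertLog (hA : IsBartlett P M.η₀ A) (hM : M.Valid)
    {g : Experts C dY → ℝ} (hg : IsExpertsPDF g) {r : Latent N C → ℝ}
    {L : Matrix (Fin dX) (Fin dX) ℝ} (hL : L ∈ choleskyFactors dX)
    (hfin : ELBOFinite M (varDensity M g r (L * Lᵀ))) {w : Latent N C} (hrw : r w ≠ 0) :
    Integrable fun m => g m * expertLog M g r w m := by
  have hS := posDef_mul_transpose hL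
  have hgate := hA.integral_wishartPDF_mul hM.η₀_gt hL (continuous_gateLog M (L * Lᵀ) w)
    (hA.integral_gateLog hM w hL).1
  have hW := hA.integral_wishartPDF hM.η₀_gt hL
  have h1 : Integrable (fun θ : Param C dX dY =>
      wishartPDF (L * Lᵀ) M.η₀ (symMat θ.1) * (g θ.2 * expertLog M g r w θ.2)) := by
    have h2 := ((hfin w).sub ((hgate.1.mul_prod hg.integrable).const_mul (r w))).const_mul (r w)⁻¹
    refine h2.congr (ae_of_all _ fun θ => ?_)
    simp only [Pi.sub_apply]
    rw [elboIntegrand_varDensity hM hg r hS, add_sub_cancel_left, inv_mul_cancel_left₀ hrw]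
  have h3 := h1.prod_right_ae
  have h4 : ∃ᵐ v : SymCoord dX, wishartPDF (L * Lᵀ) M.η₀ (symMat v) ≠ 0 := by
    intro h
    have h0 : (fun v : SymCoord dX => wishartPDF (L * Lᵀ) M.η₀ (symMat v)) =ᵐ[volume] 0 :=
      h.mono fun v hv => not_not.mp hv
    have := hW.2
    rw [integral_eq_zero_of_ae h0] at this
    exact zero_ne_one this
  obtain ⟨v, hv0, hv⟩ := (h4.and_eventually h3).exists
  refine (hv.const_mul (wishartPDF (L * Lᵀ) M.η₀ (symMat v))⁻¹).congr (ae_of_all _ fun m => ?_)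
  exact inv_mul_cancel_left₀ hv0 _

lemma IsBartlett.elboFinite_and_integral (hA : IsBartlett P M.η₀ A) (hM : M.Valid)
    {g : Experts C dY → ℝ} (hg : IsExpertsPDF g) {r : Latent N C → ℝ}
    (hexp : ∀ w, r w ≠ 0 → Integrable fun m => g m * expertLog M g r w m)
    {L : Matrix (Fin dX) (Fin dX) ℝ} (hL : L ∈ choleskyFactors dX) (w : Latent N C) :
    Integrable (elboIntegrand M (varDensity M g r (L * Lᵀ)) w) ∧
      ∫ θ, elboIntegrand M (varDensity M g r (L * Lᵀ)) w θ =
        r w * ∫ ω, gateLog M (L * Lᵀ) w (L * A ω * (A ω)ᵀ * Lᵀ) ∂P +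
          r w * ∫ m, g m * expertLog M g r w m := by
  have hS := posDef_mul_transpose hL
  have hgate := hA.integral_wishartPDF_mul hM.η₀_gt hL (continuous_gateLog M (L * Lᵀ) w)
    (hA.integral_gateLog hM w hL).1
  have hW := hA.integral_wishartPDF hM.η₀_gt hL
  have heq : elboIntegrand M (varDensity M g r (L * Lᵀ)) w = fun θ =>
      r w * ((wishartPDF (L * Lᵀ) M.η₀ (symMat θ.1) * gateLog M (L * Lᵀ) w (symMat θ.1)) * g θ.2) +
        r w * (wishartPDF (L * Lᵀ) M.η₀ (symMat θ.1) * (g θ.2 * expertLog M g r w θ.2)) :=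
    funext fun θ => elboIntegrand_varDensity hM hg r hS w θ
  rw [heq]
  by_cases hrw : r w = 0
  · simp [hrw]
  have i1 := (hgate.1.mul_prod hg.integrable).const_mul (r w)
  have i2 := (hW.1.mul_prod (hexp w hrw)).const_mul (r w)
  refine ⟨i1.add i2, ?_⟩
  rw [Measure.volume_eq_prod, integral_add i1 i2, integral_const_mul, integral_const_mul,
    integral_prod_mul (fun v : SymCoord dX =>
      wishartPDF (L * Lᵀ) M.η₀ (symMat v) * gateLog M (L * Lᵀ) w (symMat v)) g,
    integral_prod_mul (fun v : SymCoord dX => wishartPDF (L * Lᵀ) M.η₀ (symMat v))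
      (fun m => g m * expertLog M g r w m), hgate.2, hW.2, hg.integral_eq_one, mul_one, one_mul]

lemma IsBartlett.elbo_eq (hA : IsBartlett P M.η₀ A) (hM : M.Valid)
    {g : Experts C dY → ℝ} (hg : IsExpertsPDF g) {r : Latent N C → ℝ} (hr : IsLatentPMF r)
    (hexp : ∀ w, r w ≠ 0 → Integrable fun m => g m * expertLog M g r w m)
    {L : Matrix (Fin dX) (Fin dX) ℝ} (hL : L ∈ choleskyFactors dX) :
    elbo M (varDensity M g r (L * Lᵀ)) =
      (M.η₀ / 2 * (dX - Real.log M.Λ₀.det) + ∑ w, r w * ∫ m, g m * expertLog M g r w m) -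
        objective M r P A L := by
  have h1 : ∑ n, ∑ n', bigOmega r n n' * quad (M.x n - M.x n') (L * Lᵀ) =
      ∑ w, r w * ∑ n, quad (M.x n - M.x (w n).1) (L * Lᵀ) := by
    simp_rw [Finset.mul_sum]
    rw [Finset.sum_comm]
    exact Finset.sum_congr rfl fun n _ =>
      sum_bigOmega_mul r n fun n' => quad (M.x n - M.x n') (L * Lᵀ)
  set D : ℝ := -∑ n, ∫ ω, logSumSim M n L (A ω) ∂P + M.η₀ * Real.log L.det -
          M.η₀ / 2 * (Lᵀ * M.Λ₀⁻¹ * L).trace + M.η₀ / 2 * (dX - Real.log M.Λ₀.det) with hD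
  have h2 : ∀ w, ∫ θ, elboIntegrand M (varDensity M g r (L * Lᵀ)) w θ =
      -(M.η₀ / 2) * (r w * ∑ n, quad (M.x n - M.x (w n).1) (L * Lᵀ)) + r w * D +
        r w * ∫ m, g m * expertLog M g r w m := by
    intro w
    rw [(hA.elboFinite_and_integral hM hg hexp hL w).2, (hA.integral_gateLog hM w hL).2, hD]
    ring
  rw [elbo, Finset.sum_congr rfl fun w _ => h2 w, Finset.sum_add_distrib, Finset.sum_add_distrib,
    ← Finset.mul_sum, ← Finset.sum_mul, hr.sum_eq_one, ← h1, objective, trace_scatter, hD]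
  ring

end ELBO

end SimMoE

open SimMoE

theorem proposition4 {N C dX dY : ℕ} (M : SimMoE.Model N dX dY) (hM : M.Valid)
    -- the other two factors of the mean-field posterior, held fixed
    (g : SimMoE.Experts C dY → ℝ) (hg : SimMoE.IsExpertsPDF g)
    (r : SimMoE.Latent N C → ℝ) (hr : SimMoE.IsLatentPMF r)
    -- the current iterate, whose evidence lower bound is finite
    (Λcur Lcur : Matrix (Fin dX) (Fin dX) ℝ)
    (hLcur : Lcur ∈ SimMoE.choleskyFactors dX) (hΛcur : Λcur = Lcur * Lcurᵀ)
    (hfin : SimMoE.ELBOFinite M (SimMoE.varDensity M g r Λcur))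
    -- the Bartlett variable
    {Ω : Type*} [MeasurableSpace Ω] (P : Measure Ω) [IsProbabilityMeasure P]
    (A : Ω → Matrix (Fin dX) (Fin dX) ℝ) (hA : SimMoE.IsBartlett P M.η₀ A) :
    -- every positive definite matrix has exactly one Cholesky factor
    (∀ S : Matrix (Fin dX) (Fin dX) ℝ, S.PosDef →
      ∃! L, L ∈ SimMoE.choleskyFactors dX ∧ S = L * Lᵀ) ∧
    -- all expectations involved are finite
    (∀ S : Matrix (Fin dX) (Fin dX) ℝ, S.PosDef →
      SimMoE.ELBOFinite M (SimMoE.varDensity M g r S)) ∧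
    (∀ L ∈ SimMoE.choleskyFactors dX, ∀ n,
      Integrable (fun ω => SimMoE.logSumSim M n L (A ω)) P) ∧
    -- up to a constant, the evidence lower bound is minus the objective
    (∃ K : ℝ, ∀ L ∈ SimMoE.choleskyFactors dX,
      SimMoE.elbo M (SimMoE.varDensity M g r (L * Lᵀ)) = K - SimMoE.objective M r P A L) ∧
    -- maximizing the former over positive definite matrices is minimizing the latter over
    -- Cholesky factors
    (∀ L ∈ SimMoE.choleskyFactors dX,
      (IsMaxOn (fun S => SimMoE.elbo M (SimMoE.varDensity M g r S)) {S | S.PosDef} (L * Lᵀ) ↔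
        IsMinOn (SimMoE.objective M r P A) (SimMoE.choleskyFactors dX) L)) ∧
    -- the minimum is attained
    (∃ L ∈ SimMoE.choleskyFactors dX,
      IsMinOn (SimMoE.objective M r P A) (SimMoE.choleskyFactors dX) L) := by
  subst hΛcur
  have hexp : ∀ w, r w ≠ 0 → Integrable fun m => g m * expertLog M g r w m := fun w hrw =>
    hA.integrable_expertLog hM hg hLcur hfin hrw
  refine ⟨fun S hS => existsUnique_cholesky hS, fun S hS => ?_,
    fun L _ n => hA.integrable_logSumSim hM n L, ⟨_, fun L hL => hA.elbo_eq hM hg hr hexp hL⟩,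
    fun L hL => ?_, hA.exists_isMinOn_objective hM hr⟩
  · obtain ⟨L, hL, rfl⟩ := exists_cholesky hS
    exact fun w => (hA.elboFinite_and_integral hM hg hexp hL w).1
  · simp only [isMaxOn_iff, isMinOn_iff]
    constructor
    · intro h T hT
      have := h (T * Tᵀ) (posDef_mul_transpose hT)
      rw [hA.elbo_eq hM hg hr hexp hT, hA.elbo_eq hM hg hr hexp hL] at this
      linarith
    · intro h S hS
      obtain ⟨T, hT, rfl⟩ := exists_cholesky hS
      have := h T hT
      rw [hA.elbo_eq hM hg hr hexp hT, hA.elbo_eq hM hg hr hexp hL]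
      linarith
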